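/- Let $\gamma$ be a $C^2$-smooth simple closed convex curve of positive curvature in $\mathbb R^2$, parametrized counterclockwise by arc length $s$ and symmetric with respect to the origin. Let $P$ be its perimeter, $A$ the area of the domain it bounds, and $h(\psi)=\max_{s}\langle\gamma(s),n_\psi\rangle$, $n_\psi=(\cos\psi,\sin\psi)$, its support function. Consider the phase cylinder $\mathbf A=\{(s,\delta): s\in\mathbb R/P\mathbb Z,\ 0<\delta<\pi\}$ of the billiard in $\gamma$, where $(s,\delta)$ stands for the oriented line which enters the table at $\gamma(s)$ and makes the angle $\delta$ with $\gamma'(s)$. Let $T:\mathbf A\to\mathbf A$ be the billiard map, let $\mu$ be its invariant measure $d\mu=\sin\delta\,ds\,d\delta$, and let $\psi=\psi(s)$ be the angle between the outer unit normal at $\gamma(s)$ and the horizontal. Suppose that $T$ has a continuous rotational invariant curve $\alpha\subset\mathbf A$ (a simple closed curve winding once around the cylinder) of rotation number $1/4$ which consists of $4$-periodic orbits of $T$. Let $\bar\alpha$ be the invariant curve formed by the lines of $\alpha$ with the reversed orientation (it has rotation number $3/4$), and let $\mathcal B\subset\mathbf A$ be the domain between $\alpha$ and $\bar\alpha$. Then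 $h$ is of class $C^2$, the function $h''(\psi)\sin\delta$ is $\mu$-integrable on $\mathcal B$, and $$ I:=\int_{\mathcal B} h''(\psi)\,\sin\delta\;d\mu\ \ \ge\ \ \frac38\,\bigl(P^2-4\pi A\bigr). $$ -/

import Mathlib

open MeasureTheory Set Filter Topology

noncomputable section

namespace Billiard

/-- `γ` is a counterclockwise arc-length parametrization, of class `C²`, of a simple closed convex
plane curve of positive curvature which is symmetric about the origin.  The Euclidean plane is `ℂ`.
Since `γ` has unit speed and is injective on one period, its least period `P` is the perimeter. -/
structure IsTable (γ : ℝ → ℂ) (P : ℝ) : Prop where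
  pos : 0 < P
  contDiff : ContDiff ℝ 2 γ
  periodic : Function.Periodic γ P
  simple : InjOn γ (Ico 0 P)
  unit_speed : ∀ s, ‖deriv γ s‖ = 1
  /-- The signed curvature `det (γ' s, γ'' s)` is positive. -/
  curvature_pos : ∀ s, 0 < ((starRingEnd ℂ) (deriv γ s) * deriv (deriv γ) s).im
  /-- The curve is the boundary of its convex hull. -/
  convex : frontier (convexHull ℝ (range γ)) = range γ
  symmetric : ∀ s, -γ s ∈ range γ

/-- The area of the domain bounded by the convex curve `γ`. -/
def area (γ : ℝ → ℂ) : ℝ := volume.real (convexHull ℝ (range γ))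

/-- The support function `h(ψ) = max ⟨γ, n_ψ⟩`, where `n_ψ = (cos ψ, sin ψ)`. -/
def supportFunction (γ : ℝ → ℂ) (ψ : ℝ) : ℝ :=
  ⨆ s : ℝ, inner ℝ (γ s) (Complex.exp (ψ * Complex.I))

/-- The angle `ψ` formed by the outer unit normal `-i γ'(s)` at `γ s` with the horizontal
(the choice modulo `2π` is immaterial, as `h` is `2π`-periodic). -/
def normalAngle (γ : ℝ → ℂ) (s : ℝ) : ℝ := Complex.arg (-Complex.I * deriv γ s)

/-! The phase cylinder of oriented lines meeting the table is described by its universal cover: the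
strip of pairs `(s, δ)` with `0 < δ < π`, where the pairs `(s, δ)` and `(s + P, δ)` represent the
same oriented line.  The line `(s, δ)` enters the table at `γ s` and has the direction
`exp (i δ) γ'(s)`, so that `δ` is its angle with the tangent.  Subsets of the cylinder are
described by their preimages in the strip. -/

/-- The graph of the billiard map `T`, lifted to the strip: the line `z = (s, δ)` runs from `γ s` to
`γ s₁`, makes the angle `δ` with `γ'(s)` and the angle `δ₁` with `γ'(s₁)`, and is reflected to the
line `z₁ = (s₁, δ₁)`. The lift is the standard one, `s < s₁ < s + P`. -/
def Step (γ : ℝ → ℂ) (P : ℝ) (z z₁ : ℝ × ℝ) : Prop :=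
  z.2 ∈ Ioo 0 Real.pi ∧ z₁.2 ∈ Ioo 0 Real.pi ∧ z.1 < z₁.1 ∧ z₁.1 < z.1 + P ∧
  γ z₁.1 - γ z.1 =
    ‖γ z₁.1 - γ z.1‖ * (Complex.exp (z.2 * Complex.I) * deriv γ z.1) ∧
  γ z₁.1 - γ z.1 =
    ‖γ z₁.1 - γ z.1‖ * (Complex.exp (-(z₁.2 * Complex.I)) * deriv γ z₁.1)

/-- Lifts of full orbits of the billiard map. -/
def IsOrbit (γ : ℝ → ℂ) (P : ℝ) (z : ℤ → ℝ × ℝ) : Prop :=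
  ∀ n, Step γ P (z n) (z (n + 1))

/-- `α` is (the lift of) a continuous simple closed curve in the phase cylinder which winds once
around the cylinder. -/
def IsRotationalCurve (P : ℝ) (α : Set (ℝ × ℝ)) : Prop :=
  ∃ c : ℝ → ℝ × ℝ, Continuous c ∧ range c = α ∧ (∀ t, (c t).2 ∈ Ioo 0 Real.pi) ∧
    (∀ t, c (t + 1) = c t + (P, 0)) ∧
    (∀ t t' : ℝ, ∀ k : ℤ, c t' = c t + (k * P, 0) → t' = t + k)

/-- `T(α) = α`. -/
def IsInvariant (γ : ℝ → ℂ) (P : ℝ) (α : Set (ℝ × ℝ)) : Prop :=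
  ∀ z z₁, Step γ P z z₁ → (z ∈ α ↔ z₁ ∈ α)

/-- `α` consists of `N`-periodic orbits of the billiard map. -/
def ConsistsOfPeriodicOrbits (γ : ℝ → ℂ) (P : ℝ) (N : ℕ) (α : Set (ℝ × ℝ)) : Prop :=
  ∀ w ∈ α, ∃ z : ℤ → ℝ × ℝ, IsOrbit γ P z ∧ z 0 = w ∧ (∀ n, z n ∈ α) ∧
    ∃ k : ℤ, ∀ n, z (n + N) = z n + (k * P, 0)

/-- The orbits in `α` have rotation number `r`. -/
def HasRotationNumber (γ : ℝ → ℂ) (P : ℝ) (α : Set (ℝ × ℝ)) (r : ℝ) : Prop :=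
  ∀ z : ℤ → ℝ × ℝ, IsOrbit γ P z → z 0 ∈ α →
    Tendsto (fun n : ℕ => ((z n).1 - (z 0).1) / (n * P)) atTop (𝓝 r)

/-- The lines of `α` with the reversed orientation: if `T(s, δ) = (s₁, δ₁)`, then the reversal of
the line `(s, δ)` starts at `γ s₁` and makes the angle `π - δ₁` with `γ'(s₁)`. -/
def reversed (γ : ℝ → ℂ) (P : ℝ) (α : Set (ℝ × ℝ)) : Set (ℝ × ℝ) :=
  {w | ∃ z ∈ α, ∃ z₁, Step γ P z z₁ ∧ w = (z₁.1, Real.pi - z₁.2)}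

/-- The points that can be joined to the boundary component `δ = π` without meeting `α`. -/
def upperSide (α : Set (ℝ × ℝ)) : Set (ℝ × ℝ) :=
  {z | ∃ s, JoinedIn ((univ ×ˢ Ioc 0 Real.pi) \ α) z (s, Real.pi)}

/-- The points that can be joined to the boundary component `δ = 0` without meeting `α`. -/
def lowerSide (α : Set (ℝ × ℝ)) : Set (ℝ × ℝ) :=
  {z | ∃ s, JoinedIn ((univ ×ˢ Ico 0 Real.pi) \ α) z (s, 0)}

/-- The domain of the phase cylinder between `α` and the reversed curve. -/
def regionBetween (γ : ℝ → ℂ) (P : ℝ) (α : Set (ℝ × ℝ)) : Set (ℝ × ℝ) :=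
  upperSide α ∩ lowerSide (reversed γ P α)

/-- The invariant measure `dμ = |d(cos δ) ∧ ds| = sin δ ds dδ` of the phase cylinder, carried by the
fundamental domain `[0, P) × (0, π)`. -/
def invMeasure (P : ℝ) : Measure (ℝ × ℝ) :=
  (volume.restrict (Ico 0 P ×ˢ Ioo 0 Real.pi)).withDensity
    (fun z => ENNReal.ofReal (Real.sin z.2))

/-- The function `h''(ψ) sin δ` on the phase cylinder. -/
def integrand (γ : ℝ → ℂ) (z : ℝ × ℝ) : ℝ :=
  deriv (deriv (supportFunction γ)) (normalAngle γ z.1) * Real.sin z.2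

end Billiard

end

noncomputable section

namespace Billiard

/-! ### The normal angle along a table -/

/-! Write everything in the normal angle `ψ`. Positive curvature makes `ψ` a coordinate on the
curve, with `ds = (h + h'') dψ`. Hence `P = ∫ h`, and polar filling gives `2A ≥ ∫ h (h + h'')`; only
this half of the area formula is needed, because `A` enters the bound with a negative sign.

Rigidity of the invariant curve. In the normal angle, billiard orbits solve a twist recurrence `K x₁
x₂ + K x₁ x₀ = 0`, where `K` is the cotangent of the angle of the chord with the tangent
(`IsNormalParam.strictAntiOn_chordCot`). Ordered orbits that touch coincide, so the orbits of `α`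
are strictly ordered by the parameter of the curve (`IsOrbitFamily.strictMono`). Comparing `α` with
its image under the central symmetry shows that the two agree (`IsOrbitFamily.le_of_eq`) and that
two steps of the map advance the normal by `π` (`IsOrbitFamily.two_eq`). The reflection law then
makes consecutive normals orthogonal (`IsNormalParam.quarter`) and reads `h h' + h(· + π/2) h'(· +
π/2) = 0`. So `h(x)² + h(x + π/2)² = R²` is constant, and `α` is the graph `sin δ = h / R`
(`IsNormalParam.exists_radius`).

The inequality. The region is `d < δ < π - d` with `h = R sin d` and `d(x + π/2) = π/2 - d(x)`.
Integrating `sin² δ` over `δ` turns `I` into `∫ h'' (h + h'') wedge(d) dψ`. With `u = d'` and `v =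
u'`, an integration by parts removes the terms linear in `v` and leaves `R² ∫ energy`. Averaging
over a quarter turn bounds this below by a form in `v²` and `u²` (`le_energy_add`), and the
Wirtinger inequality for `u`, which changes sign under a quarter turn, gives `∫ energy ≥ (3π/8) ∫
u²`. On the other side, Cauchy–Schwarz gives `P² - 4πA ≤ 2π ∫ h'² = π R² ∫ u²`, and `3/8` is what
remains. -/

theorem IsTable.hasDerivAt {γ : ℝ → ℂ} {P : ℝ} (hγ : IsTable γ P) (s : ℝ) :
    HasDerivAt γ (deriv γ s) s :=
  (hγ.contDiff.differentiable (by norm_num) s).hasDerivAt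

theorem IsTable.contDiff_deriv {γ : ℝ → ℂ} {P : ℝ} (hγ : IsTable γ P) :
    ContDiff ℝ 1 (deriv γ) := by
  have h : ContDiff ℝ (1 + 1) γ := by simpa [one_add_one_eq_two] using hγ.contDiff
  exact (contDiff_succ_iff_deriv.1 h).2.2

theorem IsTable.hasDerivAt_deriv {γ : ℝ → ℂ} {P : ℝ} (hγ : IsTable γ P) (s : ℝ) :
    HasDerivAt (deriv γ) (deriv (deriv γ) s) s :=
  (hγ.contDiff_deriv.differentiable (by norm_num) s).hasDerivAt

/-- The signed curvature. -/
def curvature (γ : ℝ → ℂ) (s : ℝ) : ℝ :=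
  ((starRingEnd ℂ) (deriv γ s) * deriv (deriv γ) s).im

theorem IsTable.continuous_curvature {γ : ℝ → ℂ} {P : ℝ} (hγ : IsTable γ P) :
    Continuous (curvature γ) := by
  have h1 := hγ.contDiff_deriv.continuous
  have h2 : Continuous (deriv (deriv γ)) := hγ.contDiff_deriv.continuous_deriv (by norm_num)
  unfold curvature
  exact Complex.continuous_im.comp ((Complex.continuous_conj.comp h1).mul h2)

/-- The Frenet equation: differentiating `|γ'|² = 1` shows that `γ''` is orthogonal to `γ'`. -/
theorem IsTable.deriv_deriv_eq {γ : ℝ → ℂ} {P : ℝ} (hγ : IsTable γ P) (s : ℝ) :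
    deriv (deriv γ) s = curvature γ s * Complex.I * deriv γ s := by
  have h1 : ∀ t, (deriv γ t).re ^ 2 + (deriv γ t).im ^ 2 = 1 := by
    intro t
    have := hγ.unit_speed t
    rw [← sq_eq_sq₀ (norm_nonneg _) zero_le_one, Complex.sq_norm, Complex.normSq_apply] at this
    linarith
  have hd := hγ.hasDerivAt_deriv s
  have hre := Complex.reCLM.hasFDerivAt.comp_hasDerivAt s hd
  have him := Complex.imCLM.hasFDerivAt.comp_hasDerivAt s hd
  have h2 := (hre.pow 2).add (him.pow 2)
  have h3 : ((⇑Complex.reCLM ∘ deriv γ) ^ 2 + (⇑Complex.imCLM ∘ deriv γ) ^ 2)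
      = fun _ => (1 : ℝ) := by
    ext t; simpa using h1 t
  rw [h3] at h2
  have h4 := h2.unique (hasDerivAt_const s 1)
  simp at h4
  have h5 := h1 s
  apply Complex.ext
  · simp [curvature]
    linear_combination (-(deriv (deriv γ) s).re) * h5 + (1 / 2) * (deriv γ s).re * h4
  · simp [curvature]
    linear_combination (-(deriv (deriv γ) s).im) * h5 + (1 / 2) * (deriv γ s).im * h4

/-- A continuous determination of the normal angle. -/
theorem IsTable.exists_angle {γ : ℝ → ℂ} {P : ℝ} (hγ : IsTable γ P) :
    ∃ ψ : ℝ → ℝ, (∀ s, HasDerivAt ψ (curvature γ s) s) ∧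
      ∀ s, deriv γ s = Complex.I * Complex.exp (ψ s * Complex.I) := by
  set a : ℝ := Complex.arg (-Complex.I * deriv γ 0) with ha
  refine ⟨fun s => a + ∫ u in (0 : ℝ)..s, curvature γ u, fun s => ?_, ?_⟩
  · exact (hγ.continuous_curvature.integral_hasStrictDerivAt 0 s).hasDerivAt.const_add a
  set ψ : ℝ → ℝ := fun s => a + ∫ u in (0 : ℝ)..s, curvature γ u with hψ
  have hd : ∀ s, HasDerivAt ψ (curvature γ s) s := fun s =>
    (hγ.continuous_curvature.integral_hasStrictDerivAt 0 s).hasDerivAt.const_add a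
  -- By the Frenet equation, rotating `γ'` back by the integrated curvature gives a constant vector;
  -- the initial value `a` makes it `i`.
  have h1 : ∀ s, HasDerivAt (fun s => Complex.exp (-(ψ s * Complex.I)) * deriv γ s) 0 s := by
    intro s
    have h2 := (((hd s).ofReal_comp.mul_const Complex.I).neg.cexp).mul (hγ.hasDerivAt_deriv s)
    refine h2.congr_deriv ?_
    rw [hγ.deriv_deriv_eq s]
    simp only [Pi.neg_apply]
    ring
  have h3 : ∀ s, Complex.exp (-(ψ s * Complex.I)) * deriv γ s = Complex.I := by
    intro s
    have := is_const_of_deriv_eq_zero (fun s => (h1 s).differentiableAt)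
      (fun s => (h1 s).deriv) s 0
    rw [this]
    have h4 : Complex.exp (a * Complex.I) = -Complex.I * deriv γ 0 := by
      have := Complex.norm_mul_exp_arg_mul_I (-Complex.I * deriv γ 0)
      rw [norm_mul, hγ.unit_speed, ← ha] at this
      simpa using this
    have h5 : ψ 0 = a := by simp [hψ]
    rw [h5, Complex.exp_neg, h4, mul_inv]
    have : deriv γ 0 ≠ 0 := by
      rw [← norm_ne_zero_iff, hγ.unit_speed]; norm_num
    field_simp
    simp
  intro s
  have h6 := h3 s
  rw [Complex.exp_neg, inv_mul_eq_iff_eq_mul₀ (Complex.exp_ne_zero _)] at h6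
  rw [h6, mul_comm]

/-- `ψ` is a continuous determination of the normal angle of `γ`. -/
structure IsNormalAngle (γ : ℝ → ℂ) (ψ : ℝ → ℝ) : Prop where
  hasDerivAt : ∀ s, HasDerivAt ψ (curvature γ s) s
  re : ∀ s, HasDerivAt (fun s => (γ s).re) (-Real.sin (ψ s)) s
  im : ∀ s, HasDerivAt (fun s => (γ s).im) (Real.cos (ψ s)) s
  tangent : ∀ s, deriv γ s = Complex.I * Complex.exp (ψ s * Complex.I)

theorem IsTable.exists_isNormalAngle {γ : ℝ → ℂ} {P : ℝ} (hγ : IsTable γ P) :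
    ∃ ψ : ℝ → ℝ, IsNormalAngle γ ψ := by
  obtain ⟨ψ, h1, h2⟩ := hγ.exists_angle
  refine ⟨ψ, h1, fun s => ?_, fun s => ?_, h2⟩
  · have := Complex.reCLM.hasFDerivAt.comp_hasDerivAt s (hγ.hasDerivAt s)
    rw [h2 s] at this
    simpa [Function.comp_def, Complex.exp_ofReal_mul_I_im] using this
  · have := Complex.imCLM.hasFDerivAt.comp_hasDerivAt s (hγ.hasDerivAt s)
    rw [h2 s] at this
    simpa [Function.comp_def, Complex.exp_ofReal_mul_I_re] using this

theorem linearMap_complex_apply (f : ℂ →ₗ[ℝ] ℝ) (z : ℂ) :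
    f z = z.re * f 1 + z.im * f Complex.I := by
  conv_lhs => rw [← Complex.re_add_im z]
  rw [map_add, ← Complex.real_smul]
  have : (z.re : ℂ) = z.re • (1 : ℂ) := by simp
  rw [this, map_smul, map_smul]
  simp

/-- A curve contained in a line has `γ'` and `γ''` parallel, hence zero curvature. The interior
point is what the Hahn–Banach theorem needs at a boundary point of the hull. -/
theorem IsTable.interior_nonempty {γ : ℝ → ℂ} {P : ℝ} (hγ : IsTable γ P) :
    (interior (convexHull ℝ (range γ))).Nonempty := by
  rw [(convex_convexHull ℝ _).interior_nonempty_iff_affineSpan_eq_top, affineSpan_convexHull]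
  by_contra hne
  have hnonempty : ((affineSpan ℝ (range γ) : AffineSubspace ℝ ℂ) : Set ℂ).Nonempty :=
    ⟨γ 0, subset_affineSpan ℝ _ (mem_range_self 0)⟩
  have hdir : (affineSpan ℝ (range γ)).direction < ⊤ := by
    rw [lt_top_iff_ne_top]
    intro h
    exact hne ((AffineSubspace.direction_eq_top_iff_of_nonempty hnonempty).1 h)
  obtain ⟨f, hf0, hf⟩ := Submodule.exists_le_ker_of_lt_top _ hdir
  have hconst : ∀ s, f (γ s) = f (γ 0) := by
    intro s
    have : γ s -ᵥ γ 0 ∈ (affineSpan ℝ (range γ)).direction :=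
      AffineSubspace.vsub_mem_direction (subset_affineSpan ℝ _ (mem_range_self s))
        (subset_affineSpan ℝ _ (mem_range_self 0))
    have h := hf this
    rw [LinearMap.mem_ker, vsub_eq_sub, map_sub, sub_eq_zero] at h
    exact h
  set g := LinearMap.toContinuousLinearMap f
  have h1 : ∀ s, f (deriv γ s) = 0 := by
    intro s
    have h := g.hasFDerivAt.comp_hasDerivAt s (hγ.hasDerivAt s)
    have h' : (g ∘ γ) = fun _ => f (γ 0) := funext hconst
    rw [h'] at h
    exact h.unique (hasDerivAt_const s _)
  have h2 : f (deriv (deriv γ) 0) = 0 := by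
    have h := g.hasFDerivAt.comp_hasDerivAt 0 (hγ.hasDerivAt_deriv 0)
    have h' : (g ∘ deriv γ) = fun _ => (0 : ℝ) := funext h1
    rw [h'] at h
    exact h.unique (hasDerivAt_const 0 _)
  have hk := hγ.curvature_pos 0
  apply hf0
  have hb := linearMap_complex_apply f
  have e1 := h1 0
  rw [hb] at e1 h2
  simp at hk
  replace hk := sub_pos.2 hk
  have hi : f 1 = 0 := by
    apply mul_right_cancel₀ hk.ne'
    linear_combination (deriv (deriv γ) 0).im * e1 - (deriv γ 0).im * h2
  have hj : f Complex.I = 0 := by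
    apply mul_right_cancel₀ hk.ne'
    linear_combination -(deriv (deriv γ) 0).re * e1 + (deriv γ 0).re * h2
  ext z
  rw [hb, hi, hj]
  simp

/-! ### Supporting lines of a table -/

theorem IsNormalAngle.continuous {γ : ℝ → ℂ} {ψ : ℝ → ℝ} (hψ : IsNormalAngle γ ψ) :
    Continuous ψ :=
  continuous_iff_continuousAt.2 fun s => (hψ.hasDerivAt s).continuousAt

theorem IsTable.strictMono_angle {γ : ℝ → ℂ} {P : ℝ} {ψ : ℝ → ℝ} (hγ : IsTable γ P)
    (hψ : IsNormalAngle γ ψ) : StrictMono ψ :=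
  strictMono_of_deriv_pos fun s => by
    rw [(hψ.hasDerivAt s).deriv]; exact hγ.curvature_pos s

theorem IsTable.deriv_periodic {γ : ℝ → ℂ} {P : ℝ} (hγ : IsTable γ P) (s : ℝ) :
    deriv γ (s + P) = deriv γ s := by
  rw [← deriv_comp_add_const]
  congr 1
  exact funext hγ.periodic

theorem IsTable.curvature_periodic {γ : ℝ → ℂ} {P : ℝ} (hγ : IsTable γ P) (s : ℝ) :
    curvature γ (s + P) = curvature γ s := by
  have : deriv (deriv γ) (s + P) = deriv (deriv γ) s := by
    rw [← deriv_comp_add_const]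
    congr 1
    exact funext hγ.deriv_periodic
  rw [curvature, curvature, hγ.deriv_periodic, this]

/-- Periodicity of `γ'` determines `ψ` modulo `2π`, and `ψ` increases. That `k = 1` needs simplicity
and convexity, and is shown in `IsTable.angle_add_period`. -/
theorem IsTable.exists_turning {γ : ℝ → ℂ} {P : ℝ} {ψ : ℝ → ℝ} (hγ : IsTable γ P)
    (hψ : IsNormalAngle γ ψ) :
    ∃ k : ℤ, 1 ≤ k ∧ ∀ s, ψ (s + P) = ψ s + k * (2 * Real.pi) := by
  have h1 : Complex.exp (ψ (0 + P) * Complex.I) = Complex.exp (ψ 0 * Complex.I) := by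
    have := hγ.deriv_periodic 0
    rw [hψ.tangent, hψ.tangent] at this
    exact mul_left_cancel₀ Complex.I_ne_zero this
  obtain ⟨k, hk⟩ := Complex.exp_eq_exp_iff_exists_int.1 h1
  have hk' : ψ (0 + P) = ψ 0 + k * (2 * Real.pi) := by
    have h2 : (ψ (0 + P) : ℂ) * Complex.I
        = ((ψ 0 + k * (2 * Real.pi) : ℝ) : ℂ) * Complex.I := by
      rw [hk]; push_cast; ring
    exact_mod_cast mul_right_cancel₀ Complex.I_ne_zero h2
  have hpi := Real.pi_pos
  refine ⟨k, ?_, fun s => ?_⟩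
  · have h3 := hγ.strictMono_angle hψ (show (0 : ℝ) < 0 + P by linarith [hγ.pos])
    rw [hk'] at h3
    have h4 : (0 : ℝ) < k := by
      by_contra h5
      push Not at h5
      nlinarith
    exact_mod_cast h4
  · have h5 : ∀ s, HasDerivAt (fun s => ψ (s + P) - ψ s) 0 s := fun s => by
      have := ((hψ.hasDerivAt (s + P)).comp_add_const s P).sub (hψ.hasDerivAt s)
      rw [hγ.curvature_periodic, sub_self] at this
      exact this
    have h6 := is_const_of_deriv_eq_zero (fun s => (h5 s).differentiableAt)
      (fun s => (h5 s).deriv) s 0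
    linarith

theorem IsNormalAngle.hasDerivAt_height {γ : ℝ → ℂ} {ψ : ℝ → ℝ} (hψ : IsNormalAngle γ ψ)
    (x t : ℝ) :
    HasDerivAt (fun t => (γ t).re * Real.cos x + (γ t).im * Real.sin x)
      (Real.sin (x - ψ t)) t := by
  refine (((hψ.re t).mul_const _).add ((hψ.im t).mul_const _)).congr_deriv ?_
  rw [Real.sin_sub]; ring

theorem IsTable.exists_angle_eq {γ : ℝ → ℂ} {P : ℝ} {ψ : ℝ → ℝ} (hγ : IsTable γ P)
    (hψ : IsNormalAngle γ ψ) {s x : ℝ} (h1 : ψ s < x) (h2 : x < ψ (s + P)) :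
    ∃ t ∈ Ioo s (s + P), ψ t = x := by
  have hP := hγ.pos
  exact intermediate_value_Ioo (by linarith) hψ.continuous.continuousOn ⟨h1, h2⟩

/-- The line through `γ s` orthogonal to the normal is a supporting line. -/
theorem IsTable.height_le {γ : ℝ → ℂ} {P : ℝ} {ψ : ℝ → ℝ} (hγ : IsTable γ P)
    (hψ : IsNormalAngle γ ψ) (s t : ℝ) :
    (γ t).re * Real.cos (ψ s) + (γ t).im * Real.sin (ψ s) ≤
      (γ s).re * Real.cos (ψ s) + (γ s).im * Real.sin (ψ s) := by
  have hmem : γ s ∉ interior (convexHull ℝ (range γ)) := by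
    have : γ s ∈ frontier (convexHull ℝ (range γ)) := by
      rw [hγ.convex]; exact mem_range_self s
    exact this.2
  obtain ⟨f, hf0, hf⟩ := geometric_hahn_banach_of_nonempty_interior_point
    (convex_convexHull ℝ _) hmem hγ.interior_nonempty
  have hfs : ∀ t, f (γ t) ≤ f (γ s) := fun t => hf _ (subset_convexHull ℝ _ (mem_range_self t))
  have hb : ∀ z : ℂ, f z = z.re * f 1 + z.im * f Complex.I :=
    linearMap_complex_apply f.toLinearMap
  have hd : ∀ t, HasDerivAt (fun t => f (γ t))
      (-Real.sin (ψ t) * f 1 + Real.cos (ψ t) * f Complex.I) t := by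
    intro t
    have : (fun t => f (γ t)) = fun t => (γ t).re * f 1 + (γ t).im * f Complex.I :=
      funext fun t => hb (γ t)
    rw [this]
    exact ((hψ.re t).mul_const _).add ((hψ.im t).mul_const _)
  -- The supporting functional is maximal at `γ s`, so it kills the tangent and is a multiple `c` of
  -- the height in the normal direction.
  have h0 : -Real.sin (ψ s) * f 1 + Real.cos (ψ s) * f Complex.I = 0 := by
    rw [← (hd s).deriv]
    exact IsLocalMax.deriv_eq_zero (Eventually.of_forall hfs)
  set c : ℝ := Real.cos (ψ s) * f 1 + Real.sin (ψ s) * f Complex.I with hc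
  have hcs := Real.sin_sq_add_cos_sq (ψ s)
  have h1 : f 1 = c * Real.cos (ψ s) := by
    linear_combination (-f 1) * hcs + (-Real.sin (ψ s)) * h0
  have hI : f Complex.I = c * Real.sin (ψ s) := by
    linear_combination (-f Complex.I) * hcs + (Real.cos (ψ s)) * h0
  have hc0 : c ≠ 0 := by
    intro h
    apply hf0
    ext z
    rw [hb, h1, hI, h, zero_mul, zero_mul, mul_zero, mul_zero, add_zero]
    rfl
  have hcpos : 0 < c := by
    rcases lt_or_gt_of_ne hc0 with hneg | hpos
    · exfalso
      obtain ⟨k, hk1, hk⟩ := hγ.exists_turning hψ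
      have hk1' : (1 : ℝ) ≤ k := by exact_mod_cast hk1
      have hpi := Real.pi_pos
      -- If `c < 0`, then `f ∘ γ` has derivative `-c sin (ψ r - ψ s) > 0` until the normal has
      -- turned by `π`, against maximality at `s`.
      obtain ⟨t, ht, hts⟩ := hγ.exists_angle_eq hψ (s := s) (x := ψ s + Real.pi)
        (by linarith) (by rw [hk]; nlinarith)
      have hmono : StrictMonoOn (fun t => f (γ t)) (Icc s t) := by
        apply strictMonoOn_of_deriv_pos (convex_Icc _ _)
        · exact fun t _ => (hd t).continuousAt.continuousWithinAt
        · intro r hr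
          rw [interior_Icc] at hr
          have e1 := hγ.strictMono_angle hψ hr.1
          have e2 := hγ.strictMono_angle hψ hr.2
          have e3 := Real.sin_pos_of_pos_of_lt_pi (x := ψ r - ψ s) (by linarith) (by linarith)
          rw [(hd r).deriv, h1, hI]
          rw [Real.sin_sub] at e3
          nlinarith
      have := hmono (left_mem_Icc.2 ht.1.le) (right_mem_Icc.2 ht.1.le) ht.1
      exact absurd (hfs t) (not_le.2 this)
    · exact hpos
  have := hfs t
  rw [hb, hb (γ s), h1, hI] at this
  by_contra hlt
  push Not at hlt
  nlinarith

/-- Strict convexity. Otherwise a whole segment of the supporting line lies on the curve; each of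
its points has its normal in `x + πℤ`, which leaves only countably many points. -/
theorem IsTable.eq_of_height_eq {γ : ℝ → ℂ} {P : ℝ} {ψ : ℝ → ℝ} (hγ : IsTable γ P)
    (hψ : IsNormalAngle γ ψ) {s t : ℝ}
    (h : (γ t).re * Real.cos (ψ s) + (γ t).im * Real.sin (ψ s) =
      (γ s).re * Real.cos (ψ s) + (γ s).im * Real.sin (ψ s)) : γ t = γ s := by
  by_contra hne
  set x := ψ s with hx
  set H : ℂ → ℝ := fun z => z.re * Real.cos x + z.im * Real.sin x with hH
  have hconv : ∀ z ∈ convexHull ℝ (range γ), H z ≤ H (γ s) := by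
    have hlin : IsLinearMap ℝ H := ⟨fun a b => by simp [hH]; ring, fun a b => by simp [hH]; ring⟩
    have : convexHull ℝ (range γ) ⊆ {z | H z ≤ H (γ s)} := by
      apply convexHull_min
      · rintro _ ⟨r, rfl⟩
        exact hγ.height_le hψ s r
      · exact convex_halfSpace_le hlin _
    exact this
  set p : ℝ → ℂ := fun u => γ s + u • (γ t - γ s) with hp
  have hpinj : Function.Injective p := by
    intro u v huv
    simp only [hp, add_right_inj] at huv
    exact smul_left_injective ℝ (sub_ne_zero.2 hne) huv
  have hpH : ∀ u, H (p u) = H (γ s) := by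
    intro u
    have h' : H (γ t) = H (γ s) := h
    simp only [hH, hp] at h' ⊢
    simp
    linear_combination u * h'
  have hpmem : ∀ u ∈ Icc (0 : ℝ) 1, p u ∈ range γ := by
    intro u hu
    have hpc : p u ∈ convexHull ℝ (range γ) := by
      apply (convex_convexHull ℝ (range γ)).add_smul_sub_mem _ _ hu
      · exact subset_convexHull ℝ _ (mem_range_self s)
      · exact subset_convexHull ℝ _ (mem_range_self t)
    rw [← hγ.convex]
    refine ⟨subset_closure hpc, fun hint => ?_⟩
    -- A point of the segment cannot be interior to the hull: pushing it outward along the normal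
    -- leaves the supporting half-plane.
    have hcont : Tendsto (fun r : ℝ => p u + r • Complex.exp (x * Complex.I)) (𝓝[>] 0)
        (𝓝 (p u)) := by
      have : Continuous (fun r : ℝ => p u + r • Complex.exp (x * Complex.I)) := by fun_prop
      have := this.tendsto 0
      simp only [zero_smul, add_zero] at this
      exact this.mono_left nhdsWithin_le_nhds
    have hev := hcont.eventually (isOpen_interior.mem_nhds hint)
    obtain ⟨r, hr, hr0⟩ := (hev.and self_mem_nhdsWithin).exists
    have h2 := hconv _ (interior_subset hr)
    have h3 : H (p u + r • Complex.exp (x * Complex.I)) = H (p u) + r := by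
      simp only [hH]
      simp [Complex.exp_ofReal_mul_I_re, Complex.exp_ofReal_mul_I_im]
      linear_combination r * Real.sin_sq_add_cos_sq x
    rw [h3, hpH] at h2
    have : (0 : ℝ) < r := hr0
    linarith
  have hcount : (p ⁻¹' (γ '' (ψ ⁻¹' (range fun n : ℤ => x - n * Real.pi)))).Countable := by
    apply Countable.preimage _ hpinj
    apply Countable.image
    exact (countable_range _).preimage (hγ.strictMono_angle hψ).injective
  have hsub : Icc (0 : ℝ) 1 ⊆ p ⁻¹' (γ '' (ψ ⁻¹' (range fun n : ℤ => x - n * Real.pi))) := by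
    intro u hu
    obtain ⟨r, hr⟩ := hpmem u hu
    refine ⟨r, ?_, hr⟩
    have hmax : IsLocalMax (fun t => (γ t).re * Real.cos x + (γ t).im * Real.sin x) r := by
      refine Eventually.of_forall fun v => ?_
      have h4 := hpH u
      rw [← hr] at h4
      exact (hγ.height_le hψ s v).trans h4.ge
    have h5 := hmax.deriv_eq_zero
    rw [(hψ.hasDerivAt_height x r).deriv] at h5
    obtain ⟨n, hn⟩ := Real.sin_eq_zero_iff.1 h5
    exact ⟨n, by simp only [hn]; ring⟩
  have := hcount.mono hsub
  rw [Cardinal.Real.Icc_countable_iff] at this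
  linarith

/-- With two or more turns, some `t` strictly between `0` and `P` has the same normal as `0`. Both
points then lie on the same supporting line, so they coincide, against simplicity. -/
theorem IsTable.angle_add_period {γ : ℝ → ℂ} {P : ℝ} {ψ : ℝ → ℝ} (hγ : IsTable γ P)
    (hψ : IsNormalAngle γ ψ) (s : ℝ) : ψ (s + P) = ψ s + 2 * Real.pi := by
  obtain ⟨k, hk1, hk⟩ := hγ.exists_turning hψ
  have hpi := Real.pi_pos
  rcases hk1.eq_or_lt with h | h
  · rw [hk, ← h]; simp
  exfalso
  have hk2 : (2 : ℝ) ≤ k := by exact_mod_cast h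
  obtain ⟨t, ht, hts⟩ := hγ.exists_angle_eq hψ (s := 0) (x := ψ 0 + 2 * Real.pi)
    (by linarith) (by rw [hk]; nlinarith)
  have h1 := hγ.height_le hψ 0 t
  have h2 := hγ.height_le hψ t 0
  rw [hts, Real.cos_add_two_pi, Real.sin_add_two_pi] at h2
  have h3 := hγ.eq_of_height_eq hψ (le_antisymm h1 h2)
  have h4 := hγ.simple ⟨ht.1.le, by linarith [ht.2]⟩ ⟨le_rfl, hγ.pos⟩ h3
  linarith [ht.1]

/-! ### Parametrization of a table by the normal angle -/

theorem surjective_of_add_eq {f : ℝ → ℝ} (hf : Continuous f) {a b : ℝ} (ha : 0 < a) (hb : 0 < b)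
    (hab : ∀ x, f (x + a) = f x + b) : Function.Surjective f := by
  intro x
  have hper : Function.Periodic (fun s => f s - b / a * s) a := fun s => by
    simp only [hab]
    field_simp
    ring
  have hn : ∀ n : ℤ, f (n * a) = f 0 + n * b := fun n => by
    have := hper.int_mul n 0
    simp only [zero_add, mul_zero, sub_zero] at this
    have h2 : b / a * (n * a) = n * b := by field_simp
    linarith
  set n : ℤ := ⌊(x - f 0) / b⌋ with hndef
  have h1 : (n : ℝ) ≤ (x - f 0) / b := Int.floor_le _
  have h2 : (x - f 0) / b < n + 1 := Int.lt_floor_add_one _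
  rw [le_div_iff₀ hb] at h1
  rw [div_lt_iff₀ hb] at h2
  have h3 : f ((n : ℝ) * a + a) = f (n * a) + b := hab _
  rw [hn] at h3
  obtain ⟨t, -, ht⟩ := intermediate_value_Icc (show (n : ℝ) * a ≤ n * a + a by linarith)
    hf.continuousOn (show x ∈ Icc _ _ from ⟨by rw [hn]; linarith, by linarith⟩)
  exact ⟨t, ht⟩

theorem IsTable.surjective_angle {γ : ℝ → ℂ} {P : ℝ} {ψ : ℝ → ℝ} (hγ : IsTable γ P)
    (hψ : IsNormalAngle γ ψ) : Function.Surjective ψ :=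
  surjective_of_add_eq hψ.continuous hγ.pos (by positivity) (hγ.angle_add_period hψ)

theorem inner_exp_eq (z : ℂ) (x : ℝ) :
    inner ℝ z (Complex.exp (x * Complex.I)) = z.re * Real.cos x + z.im * Real.sin x := by
  rw [Complex.inner, Complex.mul_re, Complex.exp_ofReal_mul_I_re, Complex.exp_ofReal_mul_I_im,
    Complex.conj_re, Complex.conj_im]
  ring

theorem IsTable.supportFunction_angle {γ : ℝ → ℂ} {P : ℝ} {ψ : ℝ → ℝ} (hγ : IsTable γ P)
    (hψ : IsNormalAngle γ ψ) (s : ℝ) :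
    supportFunction γ (ψ s) = (γ s).re * Real.cos (ψ s) + (γ s).im * Real.sin (ψ s) := by
  unfold supportFunction
  simp_rw [inner_exp_eq]
  exact le_antisymm (ciSup_le fun t => hγ.height_le hψ s t)
    (le_ciSup (f := fun t => (γ t).re * Real.cos (ψ s) + (γ t).im * Real.sin (ψ s))
      ⟨_, by rintro _ ⟨t, rfl⟩; exact hγ.height_le hψ s t⟩ s)

theorem IsTable.height_le_supportFunction {γ : ℝ → ℂ} {P : ℝ} {ψ : ℝ → ℝ} (hγ : IsTable γ P)
    (hψ : IsNormalAngle γ ψ) (t x : ℝ) :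
    (γ t).re * Real.cos x + (γ t).im * Real.sin x ≤ supportFunction γ x := by
  obtain ⟨s, rfl⟩ := hγ.surjective_angle hψ x
  rw [hγ.supportFunction_angle hψ]
  exact hγ.height_le hψ s t

/-- `σ` is the inverse of the normal angle `ψ`, and the curve `γ ∘ σ` is expressed by the
support function. -/
structure IsNormalParam (γ : ℝ → ℂ) (P : ℝ) (ψ σ : ℝ → ℝ) : Prop where
  left_inv : ∀ s, σ (ψ s) = s
  right_inv : ∀ x, ψ (σ x) = x
  strictMono : StrictMono ψ
  contDiff : ContDiff ℝ 2 (supportFunction γ)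
  pos : ∀ x, 0 < supportFunction γ x
  periodic : Function.Periodic (supportFunction γ) Real.pi
  radius_pos : ∀ x, 0 < supportFunction γ x + deriv (deriv (supportFunction γ)) x
  hasDerivAt : ∀ x, HasDerivAt σ (supportFunction γ x + deriv (deriv (supportFunction γ)) x) x
  angle_add : ∀ s, ψ (s + P) = ψ s + 2 * Real.pi
  tangent : ∀ s, deriv γ s = Complex.I * Complex.exp (ψ s * Complex.I)
  re : ∀ x, (γ (σ x)).re =
    supportFunction γ x * Real.cos x - deriv (supportFunction γ) x * Real.sin x
  im : ∀ x, (γ (σ x)).im =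
    supportFunction γ x * Real.sin x + deriv (supportFunction γ) x * Real.cos x

theorem IsTable.supportFunction_add_pi {γ : ℝ → ℂ} {P : ℝ} (hγ : IsTable γ P) (x : ℝ) :
    supportFunction γ (x + Real.pi) = supportFunction γ x := by
  obtain ⟨ψ, hψ⟩ := hγ.exists_isNormalAngle
  have key : ∀ x y : ℝ, Real.cos y = -Real.cos x → Real.sin y = -Real.sin x →
      supportFunction γ x ≤ supportFunction γ y := by
    intro x y hc hs
    obtain ⟨s, rfl⟩ := hγ.surjective_angle hψ x
    rw [hγ.supportFunction_angle hψ]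
    obtain ⟨t, ht⟩ := hγ.symmetric s
    have := hγ.height_le_supportFunction hψ t y
    rw [ht, hc, hs, Complex.neg_re, Complex.neg_im] at this
    linarith
  refine le_antisymm (key _ _ ?_ ?_) (key _ _ ?_ ?_) <;>
    simp [Real.cos_add_pi, Real.sin_add_pi]

theorem IsTable.injOn_Ico {γ : ℝ → ℂ} {P : ℝ} (hγ : IsTable γ P) (s : ℝ) :
    InjOn γ (Ico s (s + P)) := by
  intro a ha b hb hab
  have hP := hγ.pos
  have h1 : γ (toIcoMod hP 0 a) = γ (toIcoMod hP 0 b) := by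
    rw [toIcoMod, toIcoMod, hγ.periodic.sub_zsmul_eq, hγ.periodic.sub_zsmul_eq, hab]
  have h2 := hγ.simple (by simpa using toIcoMod_mem_Ico hP 0 a)
    (by simpa using toIcoMod_mem_Ico hP 0 b) h1
  have h3 : toIcoMod hP s a = toIcoMod hP s b := (toIcoMod_inj hP).2 ((toIcoMod_inj hP).1 h2)
  rwa [(toIcoMod_eq_self hP).2 ha, (toIcoMod_eq_self hP).2 hb] at h3

/-- By symmetry the table lies in the strip of half-width `h`. If `h = 0`, then `γ s` and `γ (s + P
/ 2)` lie on one supporting line, which strict convexity forbids. -/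
theorem IsTable.supportFunction_pos {γ : ℝ → ℂ} {P : ℝ} (hγ : IsTable γ P) (x : ℝ) :
    0 < supportFunction γ x := by
  obtain ⟨ψ, hψ⟩ := hγ.exists_isNormalAngle
  obtain ⟨s, rfl⟩ := hγ.surjective_angle hψ x
  have hP := hγ.pos
  have h1 := hγ.height_le_supportFunction hψ (s + P / 2) (ψ s)
  have h3 := hγ.height_le_supportFunction hψ (s + P / 2) (ψ s + Real.pi)
  rw [hγ.supportFunction_add_pi, Real.cos_add_pi, Real.sin_add_pi] at h3
  have h4 : 0 ≤ supportFunction γ (ψ s) := by linarith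
  refine h4.lt_of_ne fun h0 => ?_
  rw [← h0] at h1 h3
  have h5 := hγ.supportFunction_angle hψ s
  have h6 := hγ.eq_of_height_eq hψ (s := s) (t := s + P / 2) (by linarith)
  have := hγ.injOn_Ico s ⟨by linarith, by linarith⟩ ⟨le_rfl, by linarith⟩ h6
  linarith

/-- In the derivative of `h = X cos x + Y sin x` the terms with `X'` and `Y'` cancel, because the
tangent is orthogonal to the normal. So `h'` has no derivative of `σ` in it, and `h'' = 1/κ - h` is
continuous although `γ` is only `C²`. -/
theorem IsTable.exists_isNormalParam {γ : ℝ → ℂ} {P : ℝ} (hγ : IsTable γ P) :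
    ∃ ψ σ : ℝ → ℝ, IsNormalParam γ P ψ σ := by
  obtain ⟨ψ, hψ⟩ := hγ.exists_isNormalAngle
  have mono := hγ.strictMono_angle hψ
  set e : ℝ ≃o ℝ := mono.orderIsoOfSurjective ψ (hγ.surjective_angle hψ) with he
  set σ : ℝ → ℝ := fun x => e.symm x with hσ
  have hl : ∀ s, σ (ψ s) = s := fun s => e.symm_apply_apply s
  have hr : ∀ x, ψ (σ x) = x := fun x => e.apply_symm_apply x
  have hσc : Continuous σ := e.symm.toHomeomorph.continuous
  have hκ : ∀ s, 0 < curvature γ s := hγ.curvature_pos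
  set ρ : ℝ → ℝ := fun x => (curvature γ (σ x))⁻¹ with hρ
  have hρc : Continuous ρ :=
    (hγ.continuous_curvature.comp hσc).inv₀ fun x => (hκ _).ne'
  have hd : ∀ x, HasDerivAt σ (ρ x) x := fun x =>
    (hψ.hasDerivAt (σ x)).of_local_left_inverse hσc.continuousAt (hκ _).ne'
      (Eventually.of_forall hr)
  have hX : ∀ x, HasDerivAt (fun x => (γ (σ x)).re) (-Real.sin x * ρ x) x := fun x => by
    have := (hψ.re (σ x)).comp x (hd x)
    rwa [hr] at this
  have hY : ∀ x, HasDerivAt (fun x => (γ (σ x)).im) (Real.cos x * ρ x) x := fun x => by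
    have := (hψ.im (σ x)).comp x (hd x)
    rwa [hr] at this
  have hh : supportFunction γ =
      fun x => (γ (σ x)).re * Real.cos x + (γ (σ x)).im * Real.sin x := funext fun x => by
    have := hγ.supportFunction_angle hψ (σ x)
    rwa [hr] at this
  have hd1 : ∀ x, HasDerivAt (supportFunction γ)
      (-(γ (σ x)).re * Real.sin x + (γ (σ x)).im * Real.cos x) x := fun x => by
    rw [hh]
    refine (((hX x).mul (Real.hasDerivAt_cos x)).add
      ((hY x).mul (Real.hasDerivAt_sin x))).congr_deriv ?_
    ring
  have hd1' : deriv (supportFunction γ) =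
      fun x => -(γ (σ x)).re * Real.sin x + (γ (σ x)).im * Real.cos x :=
    funext fun x => (hd1 x).deriv
  have hd2 : ∀ x, HasDerivAt (deriv (supportFunction γ)) (ρ x - supportFunction γ x) x :=
    fun x => by
    rw [hd1', hh]
    refine (((hX x).neg.mul (Real.hasDerivAt_sin x)).add
      ((hY x).mul (Real.hasDerivAt_cos x))).congr_deriv ?_
    simp only [Pi.neg_apply]
    linear_combination ρ x * Real.sin_sq_add_cos_sq x
  have hd2' : deriv (deriv (supportFunction γ)) = fun x => ρ x - supportFunction γ x :=
    funext fun x => (hd2 x).deriv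
  have hcont : Continuous (supportFunction γ) :=
    continuous_iff_continuousAt.2 fun x => (hd1 x).continuousAt
  have hsum : ∀ x, supportFunction γ x + deriv (deriv (supportFunction γ)) x = ρ x := by
    intro x; rw [hd2']; ring
  refine ⟨ψ, σ, hl, hr, mono, ?_, hγ.supportFunction_pos, hγ.supportFunction_add_pi, ?_, ?_,
    hγ.angle_add_period hψ, hψ.tangent, ?_, ?_⟩
  · rw [show (2 : WithTop ℕ∞) = 1 + 1 from one_add_one_eq_two.symm, contDiff_succ_iff_deriv]
    refine ⟨fun x => (hd1 x).differentiableAt, by simp, ?_⟩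
    rw [contDiff_one_iff_deriv]
    refine ⟨fun x => (hd2 x).differentiableAt, ?_⟩
    rw [hd2']
    exact hρc.sub hcont
  · intro x
    rw [hsum]
    exact inv_pos.2 (hκ _)
  · intro x
    rw [hsum]
    exact hd x
  · intro x
    rw [hd1', hh]
    linear_combination -(γ (σ x)).re * Real.sin_sq_add_cos_sq x
  · intro x
    rw [hd1', hh]
    linear_combination -(γ (σ x)).im * Real.sin_sq_add_cos_sq x

/-! ### The area of a table -/

section SupportFunction

variable {γ : ℝ → ℂ} {P : ℝ} {ψ σ : ℝ → ℝ}

theorem IsNormalParam.continuous_support (hp : IsNormalParam γ P ψ σ) :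
    Continuous (supportFunction γ) := hp.contDiff.continuous

theorem IsNormalParam.contDiff_deriv (hp : IsNormalParam γ P ψ σ) :
    ContDiff ℝ 1 (deriv (supportFunction γ)) := by
  have h : ContDiff ℝ (1 + 1) (supportFunction γ) := by
    simpa [one_add_one_eq_two] using hp.contDiff
  exact (contDiff_succ_iff_deriv.1 h).2.2

theorem IsNormalParam.continuous_deriv (hp : IsNormalParam γ P ψ σ) :
    Continuous (deriv (supportFunction γ)) := hp.contDiff_deriv.continuous

theorem IsNormalParam.continuous_deriv_deriv (hp : IsNormalParam γ P ψ σ) :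
    Continuous (deriv (deriv (supportFunction γ))) :=
  hp.contDiff_deriv.continuous_deriv (by norm_num)

theorem IsNormalParam.hasDerivAt_support (hp : IsNormalParam γ P ψ σ) (x : ℝ) :
    HasDerivAt (supportFunction γ) (deriv (supportFunction γ) x) x :=
  (hp.contDiff.differentiable (by norm_num) x).hasDerivAt

theorem IsNormalParam.hasDerivAt_deriv (hp : IsNormalParam γ P ψ σ) (x : ℝ) :
    HasDerivAt (deriv (supportFunction γ)) (deriv (deriv (supportFunction γ)) x) x :=
  (hp.contDiff_deriv.differentiable (by norm_num) x).hasDerivAt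

theorem IsNormalParam.param_add (hp : IsNormalParam γ P ψ σ) (x : ℝ) :
    σ (x + 2 * Real.pi) = σ x + P := by
  rw [← hp.left_inv (σ x + P), hp.angle_add, hp.right_inv]

theorem IsNormalParam.hasDerivAt_re (hp : IsNormalParam γ P ψ σ) (x : ℝ) :
    HasDerivAt (fun x => supportFunction γ x * Real.cos x
        - deriv (supportFunction γ) x * Real.sin x)
      (-(supportFunction γ x + deriv (deriv (supportFunction γ)) x) * Real.sin x) x := by
  refine (((hp.hasDerivAt_support x).mul (Real.hasDerivAt_cos x)).sub
    ((hp.hasDerivAt_deriv x).mul (Real.hasDerivAt_sin x))).congr_deriv ?_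
  ring

theorem IsNormalParam.hasDerivAt_im (hp : IsNormalParam γ P ψ σ) (x : ℝ) :
    HasDerivAt (fun x => supportFunction γ x * Real.sin x
        + deriv (supportFunction γ) x * Real.cos x)
      ((supportFunction γ x + deriv (deriv (supportFunction γ)) x) * Real.cos x) x := by
  refine (((hp.hasDerivAt_support x).mul (Real.hasDerivAt_sin x)).add
    ((hp.hasDerivAt_deriv x).mul (Real.hasDerivAt_cos x))).congr_deriv ?_
  ring

end SupportFunction

/-- The radial parametrization `(r, x) ↦ r • (X x, Y x)`. -/
def radialMap (X Y : ℝ → ℝ) (p : ℝ × ℝ) : ℝ × ℝ := (p.1 * X p.2, p.1 * Y p.2)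

/-- The Jacobian of the radial map is `r (X Y' - Y X')`, and `∫ r dr = 1/2` over the unit interval.
-/
theorem volume_radialMap_image {X Y X' Y' : ℝ → ℝ} (hX : ∀ x, HasDerivAt X (X' x) x)
    (hY : ∀ x, HasDerivAt Y (Y' x) x) (hX' : Continuous X') (hY' : Continuous Y')
    (hpos : ∀ x, 0 ≤ X x * Y' x - Y x * X' x) {a b : ℝ} (hab : a ≤ b)
    (hinj : InjOn (radialMap X Y) (Ioo 0 1 ×ˢ Ioo a b)) :
    volume.real (radialMap X Y '' (Ioo 0 1 ×ˢ Ioo a b)) =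
      1 / 2 * ∫ x in a..b, (X x * Y' x - Y x * X' x) := by
  have hXc : Continuous X := continuous_iff_continuousAt.2 fun x => (hX x).continuousAt
  have hYc : Continuous Y := continuous_iff_continuousAt.2 fun x => (hY x).continuousAt
  have hmeas : MeasurableSet (Ioo (0 : ℝ) 1 ×ˢ Ioo a b) := measurableSet_Ioo.prod measurableSet_Ioo
  set D : ℝ × ℝ → (ℝ × ℝ →L[ℝ] ℝ × ℝ) := fun p =>
    (Matrix.toLin (.finTwoProd ℝ) (.finTwoProd ℝ)
      !![X p.2, p.1 * X' p.2; Y p.2, p.1 * Y' p.2]).toContinuousLinearMap with hD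
  have hder : ∀ p, HasFDerivAt (radialMap X Y) (D p) p := by
    intro p
    rw [hD]
    simp only
    rw [Matrix.toLin_finTwoProd_toContinuousLinearMap]
    have h1 := (hasFDerivAt_fst (𝕜 := ℝ) (p := p)).mul
      ((hX p.2).comp_hasFDerivAt p hasFDerivAt_snd)
    have h2 := (hasFDerivAt_fst (𝕜 := ℝ) (p := p)).mul
      ((hY p.2).comp_hasFDerivAt p hasFDerivAt_snd)
    refine (h1.prodMk h2).congr_fderiv ?_
    ext <;> simp
  have hdet : ∀ p : ℝ × ℝ, (D p).det = p.1 * (X p.2 * Y' p.2 - Y p.2 * X' p.2) := by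
    intro p
    simp only [hD, LinearMap.det_toContinuousLinearMap, LinearMap.det_toLin,
      Matrix.det_fin_two_of]
    ring
  have key := integral_image_eq_integral_abs_det_fderiv_smul volume hmeas
    (fun p _ => (hder p).hasFDerivWithinAt) hinj (fun _ => (1 : ℝ))
  rw [setIntegral_const, smul_eq_mul, mul_one] at key
  rw [key]
  have hcont : Continuous fun p : ℝ × ℝ => p.1 * (X p.2 * Y' p.2 - Y p.2 * X' p.2) := by
    fun_prop
  have h3 : ∫ p in Ioo (0 : ℝ) 1 ×ˢ Ioo a b, |(D p).det| • (1 : ℝ) =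
      ∫ p in Ioo (0 : ℝ) 1 ×ˢ Ioo a b, p.1 * (X p.2 * Y' p.2 - Y p.2 * X' p.2) := by
    refine setIntegral_congr_fun hmeas fun p hp => ?_
    simp only [smul_eq_mul, mul_one]
    rw [hdet, abs_of_nonneg (mul_nonneg hp.1.1.le (hpos _))]
  rw [h3, Measure.volume_eq_prod]
  rw [setIntegral_prod_mul (fun r : ℝ => r) (fun x => X x * Y' x - Y x * X' x)]
  rw [← integral_Ioc_eq_integral_Ioo, ← integral_Ioc_eq_integral_Ioo,
    ← intervalIntegral.integral_of_le zero_le_one, ← intervalIntegral.integral_of_le hab,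
    integral_id]
  norm_num

/-- The radial map from the origin fills part of the table injectively, with Jacobian `r h (h +
h'')`. -/
theorem IsNormalParam.half_integral_le_area {γ : ℝ → ℂ} {P : ℝ} {ψ σ : ℝ → ℝ}
    (hγ : IsTable γ P) (hp : IsNormalParam γ P ψ σ) :
    1 / 2 * ∫ x in (0 : ℝ)..2 * Real.pi, supportFunction γ x *
      (supportFunction γ x + deriv (deriv (supportFunction γ)) x) ≤ area γ := by
  set h := supportFunction γ with hh
  set X : ℝ → ℝ := fun x => h x * Real.cos x - deriv h x * Real.sin x with hX
  set Y : ℝ → ℝ := fun x => h x * Real.sin x + deriv h x * Real.cos x with hY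
  have hpi := Real.pi_pos
  have hcs := fun x => Real.sin_sq_add_cos_sq x
  have hXY : ∀ x, X x * Real.cos x + Y x * Real.sin x = h x := fun x => by
    simp only [hX, hY]; linear_combination h x * hcs x
  have hle : ∀ x y, X x * Real.cos y + Y x * Real.sin y ≤ h y := fun x y => by
    obtain ⟨ψ', hψ'⟩ := hγ.exists_isNormalAngle
    have := hγ.height_le_supportFunction hψ' (σ x) y
    rwa [hp.re, hp.im] at this
  have hdet : ∀ x, X x * ((h x + deriv (deriv h) x) * Real.cos x)
      - Y x * (-(h x + deriv (deriv h) x) * Real.sin x) = h x * (h x + deriv (deriv h) x) :=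
    fun x => by rw [← hXY x]; ring
  have hc1 := hp.continuous_support
  have hc3 := hp.continuous_deriv_deriv
  rw [← hh] at hc1 hc3
  -- Equal images force equal radii: project both onto the normal at `y`, where the second attains
  -- `h y` and the first does not exceed it.
  have hzero : ∀ r ∈ Ioo (0 : ℝ) 1, ∀ r' ∈ Ioo (0 : ℝ) 1, ∀ x y : ℝ,
      r * X x = r' * X y → r * Y x = r' * Y y → r' ≤ r := by
    intro r hr r' hr' x y e1 e2
    have h1 := hle x y
    have h2 := hXY y
    have h3 : 0 < h y := hp.pos y
    have h4 : r * (X x * Real.cos y + Y x * Real.sin y) = r' * h y := by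
      rw [← h2]; linear_combination Real.cos y * e1 + Real.sin y * e2
    have h5 := mul_le_mul_of_nonneg_left h1 hr.1.le
    rw [h4] at h5
    exact le_of_mul_le_mul_right h5 h3
  have hinj : InjOn (radialMap X Y) (Ioo 0 1 ×ˢ Ioo 0 (2 * Real.pi)) := by
    rintro ⟨r, x⟩ ⟨hr, hx⟩ ⟨r', y⟩ ⟨hr', hy⟩ heq
    simp only [radialMap, Prod.mk.injEq] at heq hr hr' hx hy ⊢
    obtain rfl : r = r' := le_antisymm
      (hzero r' hr' r hr y x heq.1.symm heq.2.symm) (hzero r hr r' hr' x y heq.1 heq.2)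
    refine ⟨rfl, ?_⟩
    have e1 := mul_left_cancel₀ hr.1.ne' heq.1
    have e2 := mul_left_cancel₀ hr.1.ne' heq.2
    have e3 : γ (σ x) = γ (σ y) := by
      apply Complex.ext
      · rw [hp.re, hp.re]; exact e1
      · rw [hp.im, hp.im]; exact e2
    have hσ : StrictMono σ := fun a b hab => by
      rwa [← hp.strictMono.lt_iff_lt, hp.right_inv, hp.right_inv]
    have e4 : σ (2 * Real.pi) = σ 0 + P := by
      have := hp.param_add 0
      rwa [zero_add] at this
    have hmem : ∀ z ∈ Ioo 0 (2 * Real.pi), σ z ∈ Ico (σ 0) (σ 0 + P) := fun z hz =>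
      ⟨(hσ hz.1).le, by rw [← e4]; exact hσ hz.2⟩
    exact hσ.injective (hγ.injOn_Ico (σ 0) (hmem x hx) (hmem y hy) e3)
  have hvol := volume_radialMap_image (X := X) (Y := Y) hp.hasDerivAt_re hp.hasDerivAt_im
    ((hc1.add hc3).neg.mul Real.continuous_sin) ((hc1.add hc3).mul Real.continuous_cos)
    (fun x => by
      have := hdet x
      rw [← hh, this]; exact (mul_pos (hp.pos x) (hp.radius_pos x)).le)
    (show 0 ≤ 2 * Real.pi by positivity) hinj
  rw [← hh] at hvol
  simp_rw [hdet] at hvol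
  rw [← hvol]
  have hbdd : Bornology.IsBounded (convexHull ℝ (range γ)) := by
    rw [isBounded_convexHull]
    exact (hγ.periodic.compact_of_continuous hγ.pos.ne' hγ.contDiff.continuous).isBounded
  have hfin : volume (convexHull ℝ (range γ)) ≠ ⊤ := hbdd.measure_lt_top.ne
  have hsub : Complex.measurableEquivRealProd ⁻¹'
      (radialMap X Y '' (Ioo 0 1 ×ˢ Ioo 0 (2 * Real.pi))) ⊆ convexHull ℝ (range γ) := by
    rintro z ⟨⟨r, x⟩, ⟨hr, -⟩, hz⟩
    simp only [radialMap, Complex.measurableEquivRealProd_apply, Prod.mk.injEq] at hz hr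
    -- The origin is the midpoint of `γ` and `-γ`, so `r γ` is a convex combination of these two.
    have hz' : z = ((1 + r) / 2) • γ (σ x) + ((1 - r) / 2) • (-γ (σ x)) := by
      apply Complex.ext
      · simp [hp.re]
        rw [← hz.1]; ring
      · simp [hp.im]
        rw [← hz.2]; ring
    rw [hz']
    exact convex_convexHull ℝ _ (subset_convexHull ℝ _ (mem_range_self _))
      (subset_convexHull ℝ _ (hγ.symmetric _)) (by linarith [hr.1]) (by linarith [hr.2])
      (by ring)
  have := measure_mono (μ := volume) hsub
  rw [Complex.volume_preserving_equiv_real_prod.measure_preimage_equiv] at this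
  exact ENNReal.toReal_mono hfin this

/-! ### An integral inequality for quarter-turn antisymmetric angles -/

/-- A Wirtinger inequality (with a non-optimal constant) for functions that change sign under a
quarter turn. -/
theorem wirtinger_quarter {u v : ℝ → ℝ} (hu : ∀ x, HasDerivAt u (v x) x) (hv : Continuous v)
    (hanti : ∀ x, u (x + Real.pi / 2) = -u x) (hvanti : ∀ x, v (x + Real.pi / 2) = -v x) :
    0 ≤ ∫ x in (0 : ℝ)..2 * Real.pi, (v x ^ 2 - (9 / 5) ^ 2 * u x ^ 2) := by
  have hpi := Real.pi_pos
  have huc : Continuous u := continuous_iff_continuousAt.2 fun x => (hu x).continuousAt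
  have hper : Function.Periodic (fun x => v x ^ 2 - (9 / 5) ^ 2 * u x ^ 2) (Real.pi / 2) := by
    intro x
    simp only [hanti, hvanti, neg_sq]
  obtain ⟨a, ha⟩ : ∃ a, u a = 0 := by
    have h0 := hanti 0
    rw [zero_add] at h0
    rcases le_total (u 0) 0 with h | h
    · obtain ⟨a, -, ha⟩ := intermediate_value_Icc (show (0 : ℝ) ≤ Real.pi / 2 by positivity)
        huc.continuousOn (show (0 : ℝ) ∈ Icc _ _ from ⟨h, by rw [h0]; linarith⟩)
      exact ⟨a, ha⟩
    · obtain ⟨a, -, ha⟩ := intermediate_value_Icc' (show (0 : ℝ) ≤ Real.pi / 2 by positivity)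
        huc.continuousOn (show (0 : ℝ) ∈ Icc _ _ from ⟨by rw [h0]; linarith, h⟩)
      exact ⟨a, ha⟩
  have hfull : ∫ x in (0 : ℝ)..2 * Real.pi, (v x ^ 2 - (9 / 5) ^ 2 * u x ^ 2) =
      4 * ∫ x in a..a + Real.pi / 2, (v x ^ 2 - (9 / 5) ^ 2 * u x ^ 2) := by
    have h1 := hper.intervalIntegral_add_zsmul_eq 4 0
      fun _ _ => Continuous.intervalIntegrable (by fun_prop) _ _
    rw [hper.intervalIntegral_add_eq 0 a] at h1
    simp only [zero_add, zsmul_eq_mul] at h1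
    push_cast at h1
    rw [← h1]
    congr 1
    ring
  rw [hfull]
  refine mul_nonneg (by norm_num) ?_
  -- Riccati method: completing the square with `k tan (k (x - a - π/4)) u²`, where `k = 9/5`. The
  -- optimal `k = 2` would put the poles of the tangent at the endpoints; with `9/5` one has `|w| ≤
  -- 9π/20 < π/2` on the closed interval. The boundary terms vanish since `u a = 0`.
  set w : ℝ → ℝ := fun x => 9 / 5 * (x - a - Real.pi / 4) with hw
  have hcos : ∀ x ∈ Icc a (a + Real.pi / 2), 0 < Real.cos (w x) := by
    intro x hx
    apply Real.cos_pos_of_mem_Ioo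
    constructor <;> simp only [hw] <;> nlinarith [hx.1, hx.2]
  have hder : ∀ x ∈ Icc a (a + Real.pi / 2),
      HasDerivAt (fun x => 9 / 5 * Real.tan (w x) * u x ^ 2)
        ((v x + 9 / 5 * Real.tan (w x) * u x) ^ 2 - (v x ^ 2 - (9 / 5) ^ 2 * u x ^ 2)) x := by
    intro x hx
    have hc := (hcos x hx).ne'
    have hw' : HasDerivAt w (9 / 5) x := by
      simpa using (((hasDerivAt_id x).sub_const a).sub_const (Real.pi / 4)).const_mul (9 / 5 : ℝ)
    have h1 := ((Real.hasDerivAt_tan hc).comp x hw').const_mul (9 / 5 : ℝ)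
    refine (h1.mul ((hu x).pow 2)).congr_deriv ?_
    have h2 : 1 / Real.cos (w x) ^ 2 = 1 + Real.tan (w x) ^ 2 := by
      rw [Real.tan_eq_sin_div_cos]
      field_simp
      linarith [Real.sin_sq_add_cos_sq (w x)]
    rw [h2]
    simp
    ring
  have htan : ContinuousOn (fun x => Real.tan (w x)) (uIcc a (a + Real.pi / 2)) := by
    rw [uIcc_of_le (by linarith)]
    intro x hx
    have hwc : Continuous w := by fun_prop
    exact ((Real.continuousAt_tan.2 (hcos x hx).ne').comp hwc.continuousAt).continuousWithinAt
  have hi1 : IntervalIntegrable (fun x => (v x + 9 / 5 * Real.tan (w x) * u x) ^ 2) volume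
      a (a + Real.pi / 2) := by
    apply ContinuousOn.intervalIntegrable
    exact (hv.continuousOn.add ((continuousOn_const.mul htan).mul huc.continuousOn)).pow 2
  have hi2 : IntervalIntegrable (fun x => v x ^ 2 - (9 / 5) ^ 2 * u x ^ 2) volume
      a (a + Real.pi / 2) := by
    apply Continuous.intervalIntegrable
    fun_prop
  have hint := intervalIntegral.integral_eq_sub_of_hasDerivAt
    (fun x hx => hder x (by rwa [uIcc_of_le (by linarith)] at hx)) (hi1.sub hi2)
  rw [intervalIntegral.integral_sub hi1 hi2, hanti, ha] at hint
  have hnn := intervalIntegral.integral_nonneg_of_forall (μ := volume)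
    (show a ≤ a + Real.pi / 2 by linarith)
    (fun x => sq_nonneg (v x + 9 / 5 * Real.tan (w x) * u x))
  simp at hint
  linarith

/-- The length of the projection of `sin² δ dδ` between `θ` and `π - θ`. -/
def wedge (θ : ℝ) : ℝ := Real.pi / 2 - θ + Real.sin θ * Real.cos θ

theorem hasDerivAt_wedge (θ : ℝ) : HasDerivAt wedge (-2 * Real.sin θ ^ 2) θ := by
  refine (((hasDerivAt_id θ).const_sub (Real.pi / 2)).add
    ((Real.hasDerivAt_sin θ).mul (Real.hasDerivAt_cos θ))).congr_deriv ?_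
  linear_combination Real.sin_sq_add_cos_sq θ

/-- The quadratic-quartic form obtained from the integrand after integration by parts. -/
def energy (θ u v : ℝ) : ℝ :=
  Real.cos θ ^ 2 * wedge θ * v ^ 2
  + (Real.sin θ ^ 2 * wedge θ + 2 / 3 * ((Real.cos θ ^ 2 - Real.sin θ ^ 2) * wedge θ
      - 2 * Real.sin θ ^ 3 * Real.cos θ)) * u ^ 4
  - (Real.cos θ ^ 2 * wedge θ - 2 * Real.sin θ ^ 3 * Real.cos θ) * u ^ 2

/-- With `θ = π/4 - b`, the quarter turn is `b ↦ -b` and exchanges sine and cosine. In the sum, the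
`v²` coefficient is at least `π/4 + 1/2` because `sin² b ≤ b sin 2b`, the `u⁴` coefficient is
nonnegative and can be dropped, and the coefficient subtracted at `u²` is at most `π/2`. -/
theorem le_energy_add {θ u v : ℝ} (h0 : 0 < θ) (h1 : θ < Real.pi / 2) :
    (Real.pi / 4 + 1 / 2) * v ^ 2 - Real.pi / 2 * u ^ 2 ≤
      energy θ u v + energy (Real.pi / 2 - θ) (-u) (-v) := by
  have hpi := Real.pi_gt_three
  obtain ⟨b, rfl⟩ : ∃ b, θ = Real.pi / 4 - b := ⟨Real.pi / 4 - θ, by ring⟩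
  have hb : |b| < Real.pi / 4 := abs_lt.2 ⟨by linarith, by linarith⟩
  have e0 : Real.pi / 2 - (Real.pi / 4 - b) = Real.pi / 4 + b := by ring
  have hs : Real.sin (Real.pi / 4 + b) = Real.cos (Real.pi / 4 - b) := by
    rw [← Real.sin_pi_div_two_sub]; congr 1; ring
  have hc : Real.cos (Real.pi / 4 + b) = Real.sin (Real.pi / 4 - b) := by
    rw [← Real.cos_pi_div_two_sub]; congr 1; ring
  set s := Real.sin (Real.pi / 4 - b) with hsdef
  set c := Real.cos (Real.pi / 4 - b) with hcdef
  have hsc : s ^ 2 + c ^ 2 = 1 := Real.sin_sq_add_cos_sq _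
  have hS : c ^ 2 - s ^ 2 = Real.sin (2 * b) := by
    rw [hsdef, hcdef, ← Real.cos_two_mul', ← Real.cos_pi_div_two_sub]
    congr 1; ring
  have hC : 2 * s * c = Real.cos (2 * b) := by
    rw [hsdef, hcdef, ← Real.sin_two_mul, ← Real.cos_pi_div_two_sub]
    congr 1; ring
  have hcosb : 1 / 2 ≤ Real.cos b := by
    rw [← Real.cos_pi_div_three, ← Real.cos_abs b]
    exact Real.cos_le_cos_of_nonneg_of_le_pi (abs_nonneg _) (by linarith) (by linarith)
  -- This is `sin² b ≤ 2 b sin b cos b`, which follows from `sin² b ≤ b sin b` and `2 cos b ≥ 1`.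
  have hlow : 1 / 2 - Real.cos (2 * b) / 2 ≤ b * Real.sin (2 * b) := by
    rw [Real.cos_two_mul', Real.sin_two_mul]
    have hcs := Real.sin_sq_add_cos_sq b
    have key : Real.sin b ^ 2 ≤ b * Real.sin b * (2 * Real.cos b) := by
      rcases le_total 0 b with hb0 | hb0
      · have h2 := Real.sin_le hb0
        have h3 := Real.sin_nonneg_of_nonneg_of_le_pi hb0 (by linarith [le_abs_self b])
        have h4 : Real.sin b ^ 2 ≤ b * Real.sin b := by nlinarith
        have h5 : 0 ≤ b * Real.sin b := mul_nonneg hb0 h3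
        nlinarith
      · have h2 := Real.le_sin hb0
        have h3 := Real.sin_nonpos_of_nonpos_of_neg_pi_le hb0 (by linarith [neg_abs_le b])
        have h4 : Real.sin b ^ 2 ≤ b * Real.sin b := by nlinarith
        have h5 : 0 ≤ b * Real.sin b := mul_nonneg_of_nonpos_of_nonpos hb0 h3
        nlinarith
    nlinarith
  have hcos1 := Real.cos_le_one (2 * b)
  have hcos0 : 0 ≤ Real.cos (2 * b) := by
    apply Real.cos_nonneg_of_mem_Icc
    constructor <;> linarith [(abs_lt.1 hb).1, (abs_lt.1 hb).2]
  have hup : b * Real.sin (2 * b) ≤ Real.pi / 4 := by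
    calc b * Real.sin (2 * b) ≤ |b * Real.sin (2 * b)| := le_abs_self _
      _ = |b| * |Real.sin (2 * b)| := abs_mul _ _
      _ ≤ |b| * 1 := by gcongr; exact Real.abs_sin_le_one _
      _ ≤ Real.pi / 4 := by linarith
  have hsum : energy (Real.pi / 4 - b) u v + energy (Real.pi / 4 + b) (-u) (-v) =
      (Real.pi / 4 + b * Real.sin (2 * b) + Real.cos (2 * b) / 2) * v ^ 2
      + (Real.pi / 4 + b * Real.sin (2 * b) / 3 - Real.cos (2 * b) / 6) * u ^ 4
      - (Real.pi / 4 + b * Real.sin (2 * b) - Real.cos (2 * b) / 2) * u ^ 2 := by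
    unfold energy wedge
    rw [hs, hc, ← hsdef, ← hcdef, ← hS, ← hC]
    have e1 : c ^ 2 = 1 - s ^ 2 := by linarith
    have e3 : c ^ 3 = (1 - s ^ 2) * c := by rw [← e1]; ring
    rw [e3, e1]
    ring
  rw [e0, hsum]
  have t1 := mul_nonneg (sub_nonneg.2 hlow) (sq_nonneg v)
  have t2 := mul_nonneg (sub_nonneg.2 hup) (sq_nonneg u)
  have t3 : 0 ≤ (Real.pi / 4 + b * Real.sin (2 * b) / 3 - Real.cos (2 * b) / 6) * u ^ 4 := by
    apply mul_nonneg _ (by positivity)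
    linarith
  have t4 := mul_nonneg hcos0 (sq_nonneg u)
  linarith

/-- A `C²` angle function `d` with values in `(0, π/2)` that is reflected by a quarter turn. -/
structure IsQuarterAngle (d u v : ℝ → ℝ) : Prop where
  hasDerivAt : ∀ x, HasDerivAt d (u x) x
  hasDerivAt' : ∀ x, HasDerivAt u (v x) x
  continuous : Continuous v
  mem : ∀ x, d x ∈ Ioo 0 (Real.pi / 2)
  quarter : ∀ x, d (x + Real.pi / 2) = Real.pi / 2 - d x

section QuarterAngle

variable {d u v : ℝ → ℝ}

theorem IsQuarterAngle.quarter' (hd : IsQuarterAngle d u v) (x : ℝ) :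
    u (x + Real.pi / 2) = -u x := by
  have h1 := (hd.hasDerivAt (x + Real.pi / 2)).comp_add_const x (Real.pi / 2)
  rw [funext hd.quarter] at h1
  exact h1.unique ((hd.hasDerivAt x).const_sub _)

theorem IsQuarterAngle.quarter'' (hd : IsQuarterAngle d u v) (x : ℝ) :
    v (x + Real.pi / 2) = -v x := by
  have h1 := (hd.hasDerivAt' (x + Real.pi / 2)).comp_add_const x (Real.pi / 2)
  rw [funext hd.quarter'] at h1
  exact h1.unique (hd.hasDerivAt' x).neg

theorem IsQuarterAngle.periodic (hd : IsQuarterAngle d u v) :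
    Function.Periodic d Real.pi := fun x => by
  have h1 := hd.quarter (x + Real.pi / 2)
  rw [hd.quarter x, add_assoc, add_halves] at h1
  linarith

theorem IsQuarterAngle.periodic' (hd : IsQuarterAngle d u v) :
    Function.Periodic u Real.pi := fun x => by
  have h1 := hd.quarter' (x + Real.pi / 2)
  rw [hd.quarter' x, add_assoc, add_halves] at h1
  linarith

theorem IsQuarterAngle.periodic'' (hd : IsQuarterAngle d u v) :
    Function.Periodic v Real.pi := fun x => by
  have h1 := hd.quarter'' (x + Real.pi / 2)
  rw [hd.quarter'' x, add_assoc, add_halves] at h1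
  linarith

theorem IsQuarterAngle.continuous_angle (hd : IsQuarterAngle d u v) : Continuous d :=
  continuous_iff_continuousAt.2 fun x => (hd.hasDerivAt x).continuousAt

theorem IsQuarterAngle.continuous' (hd : IsQuarterAngle d u v) : Continuous u :=
  continuous_iff_continuousAt.2 fun x => (hd.hasDerivAt' x).continuousAt

theorem continuous_wedge : Continuous wedge :=
  continuous_iff_continuousAt.2 fun x => (hasDerivAt_wedge x).continuousAt

/-- Symmetrization of an integral over a full turn under the quarter turn. -/
theorem integral_two_pi_eq_half {f : ℝ → ℝ} (hf : Continuous f)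
    (hper : Function.Periodic f (2 * Real.pi)) :
    ∫ x in (0 : ℝ)..2 * Real.pi, f x =
      1 / 2 * ∫ x in (0 : ℝ)..2 * Real.pi, (f x + f (x + Real.pi / 2)) := by
  have hf2 : Continuous fun x => f (x + Real.pi / 2) := by fun_prop
  rw [intervalIntegral.integral_add (hf.intervalIntegrable _ _) (hf2.intervalIntegrable _ _),
    intervalIntegral.integral_comp_add_right, zero_add, add_comm (2 * Real.pi),
    hper.intervalIntegral_add_eq (Real.pi / 2) 0, zero_add]
  ring

/-- Average over the quarter turn, apply the pointwise bound, and absorb the negative `u²` term by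
the Wirtinger inequality. -/
theorem IsQuarterAngle.integral_energy_ge (hd : IsQuarterAngle d u v) :
    3 * Real.pi / 8 * ∫ x in (0 : ℝ)..2 * Real.pi, u x ^ 2 ≤
      ∫ x in (0 : ℝ)..2 * Real.pi, energy (d x) (u x) (v x) := by
  have hpi := Real.pi_pos
  have hpi' := Real.pi_lt_d2
  have c0 := hd.continuous_angle
  have c1 := hd.continuous'
  have c2 := hd.continuous
  have hper : Function.Periodic (fun x => energy (d x) (u x) (v x)) (2 * Real.pi) := by
    intro x
    have e : x + 2 * Real.pi = x + Real.pi + Real.pi := by ring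
    simp only [e, hd.periodic _, hd.periodic' _, hd.periodic'' _]
  have cw := continuous_wedge
  have ce : Continuous fun x => energy (d x) (u x) (v x) := by
    unfold energy; fun_prop
  rw [integral_two_pi_eq_half ce hper]
  have hmono : ∫ x in (0 : ℝ)..2 * Real.pi,
      ((Real.pi / 4 + 1 / 2) * v x ^ 2 - Real.pi / 2 * u x ^ 2) ≤
      ∫ x in (0 : ℝ)..2 * Real.pi, (energy (d x) (u x) (v x)
        + energy (d (x + Real.pi / 2)) (u (x + Real.pi / 2)) (v (x + Real.pi / 2))) := by
    apply intervalIntegral.integral_mono (by positivity)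
    · exact Continuous.intervalIntegrable (by fun_prop) _ _
    · exact (ce.add (ce.comp (continuous_add_const _))).intervalIntegrable _ _
    · intro x
      simp only
      rw [hd.quarter, hd.quarter', hd.quarter'']
      exact le_energy_add (hd.mem x).1 (hd.mem x).2
  have hw := wirtinger_quarter hd.hasDerivAt' hd.continuous hd.quarter' hd.quarter''
  have i1 : IntervalIntegrable (fun x => v x ^ 2) volume 0 (2 * Real.pi) :=
    Continuous.intervalIntegrable (by fun_prop) _ _
  have i2 : IntervalIntegrable (fun x => u x ^ 2) volume 0 (2 * Real.pi) :=
    Continuous.intervalIntegrable (by fun_prop) _ _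
  rw [intervalIntegral.integral_sub i1 (i2.const_mul _),
    intervalIntegral.integral_const_mul] at hw
  rw [intervalIntegral.integral_sub (i1.const_mul _) (i2.const_mul _),
    intervalIntegral.integral_const_mul, intervalIntegral.integral_const_mul] at hmono
  have hnn : 0 ≤ ∫ x in (0 : ℝ)..2 * Real.pi, u x ^ 2 :=
    intervalIntegral.integral_nonneg_of_forall (by positivity) fun x => sq_nonneg _
  set U := ∫ x in (0 : ℝ)..2 * Real.pi, u x ^ 2
  set V := ∫ x in (0 : ℝ)..2 * Real.pi, v x ^ 2
  have h1 : (Real.pi / 4 + 1 / 2) * ((9 / 5) ^ 2 * U) ≤ (Real.pi / 4 + 1 / 2) * V := by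
    gcongr
    linarith
  -- The numerical margin: `(π/4 + 1/2)(81/25) - π/2` exceeds the required `3π/4` by `1.62 - 0.44 π
  -- > 0`.
  have h2 : 0 ≤ (1.62 - 0.44 * Real.pi) * U := mul_nonneg (by linarith) hnn
  linarith

/-- Integration by parts. -/
theorem IsQuarterAngle.integral_eq_energy (hd : IsQuarterAngle d u v) :
    ∫ x in (0 : ℝ)..2 * Real.pi, (Real.cos (d x) * v x - Real.sin (d x) * u x ^ 2) *
      (Real.sin (d x) + (Real.cos (d x) * v x - Real.sin (d x) * u x ^ 2)) * wedge (d x) =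
      ∫ x in (0 : ℝ)..2 * Real.pi, energy (d x) (u x) (v x) := by
  have c0 := hd.continuous_angle
  have c1 := hd.continuous'
  have c2 := hd.continuous
  have cw := continuous_wedge
  -- The terms linear in `v` are `sin d cos d wedge(d) (1 - 2u²) v`; integrating `1 - 2u²` in `u`
  -- gives the factor `u - (2/3) u³` of this primitive.
  have hder : ∀ x, HasDerivAt (fun x => Real.sin (d x) * Real.cos (d x) * wedge (d x)
      * (u x - 2 / 3 * u x ^ 3))
      ((Real.cos (d x) * v x - Real.sin (d x) * u x ^ 2) *
        (Real.sin (d x) + (Real.cos (d x) * v x - Real.sin (d x) * u x ^ 2)) * wedge (d x)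
        - energy (d x) (u x) (v x)) x := by
    intro x
    have h1 := (hd.hasDerivAt x).sin
    have h2 := (hd.hasDerivAt x).cos
    have h3 := (hasDerivAt_wedge (d x)).comp x (hd.hasDerivAt x)
    have h4 := (hd.hasDerivAt' x).sub (((hd.hasDerivAt' x).pow 3).const_mul (2 / 3 : ℝ))
    refine (((h1.mul h2).mul h3).mul h4).congr_deriv ?_
    simp [energy]
    ring
  have hint := intervalIntegral.integral_eq_sub_of_hasDerivAt
    (a := 0) (b := 2 * Real.pi) (fun x _ => hder x)
    (Continuous.intervalIntegrable (by unfold energy; fun_prop) _ _)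
  rw [intervalIntegral.integral_sub (Continuous.intervalIntegrable (by fun_prop) _ _)
    (Continuous.intervalIntegrable (by unfold energy; fun_prop) _ _)] at hint
  have e0 : d (2 * Real.pi) = d 0 := by
    rw [two_mul, hd.periodic, ← zero_add Real.pi, hd.periodic]
  have e1 : u (2 * Real.pi) = u 0 := by
    rw [two_mul, hd.periodic', ← zero_add Real.pi, hd.periodic']
  rw [e0, e1, sub_self] at hint
  linarith

end QuarterAngle

/-! ### Support functions with a circular orthoptic curve -/

section Orthoptic

variable {h : ℝ → ℝ} {R : ℝ}

/-- The relation gives `cos d = h(x + π/2) / R`, so `d' = h' / h(x + π/2)`. This is differentiable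
because `h` is positive and `C²`. -/
theorem exists_isQuarterAngle (hC : ContDiff ℝ 2 h) (hpos : ∀ x, 0 < h x) (hR : 0 < R)
    (hsq : ∀ x, h x ^ 2 + h (x + Real.pi / 2) ^ 2 = R ^ 2) :
    ∃ u v : ℝ → ℝ, IsQuarterAngle (fun x => Real.arcsin (h x / R)) u v ∧
      (∀ x, h x = R * Real.sin (Real.arcsin (h x / R))) ∧
      (∀ x, deriv h x = R * (Real.cos (Real.arcsin (h x / R)) * u x)) ∧
      ∀ x, deriv (deriv h) x = R * (Real.cos (Real.arcsin (h x / R)) * v x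
        - Real.sin (Real.arcsin (h x / R)) * u x ^ 2) := by
  have hpi := Real.pi_pos
  have hC1 : ContDiff ℝ 1 (deriv h) := by
    have h' : ContDiff ℝ (1 + 1) h := by simpa [one_add_one_eq_two] using hC
    exact (contDiff_succ_iff_deriv.1 h').2.2
  have hc0 : Continuous h := hC.continuous
  have hc1 : Continuous (deriv h) := hC1.continuous
  have hc2 : Continuous (deriv (deriv h)) := hC1.continuous_deriv (by norm_num)
  have d1 : ∀ x, HasDerivAt h (deriv h x) x := fun x =>
    (hC.differentiable (by norm_num) x).hasDerivAt
  have d2 : ∀ x, HasDerivAt (deriv h) (deriv (deriv h) x) x := fun x =>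
    (hC1.differentiable (by norm_num) x).hasDerivAt
  have d1q : ∀ x, HasDerivAt (fun x => h (x + Real.pi / 2)) (deriv h (x + Real.pi / 2)) x :=
    fun x => (d1 (x + Real.pi / 2)).comp_add_const x (Real.pi / 2)
  have hne : ∀ x, h (x + Real.pi / 2) ≠ 0 := fun x => (hpos _).ne'
  have hcross : ∀ x, h x * deriv h x + h (x + Real.pi / 2) * deriv h (x + Real.pi / 2) = 0 := by
    intro x
    have h1 := ((d1 x).pow 2).add ((d1q x).pow 2)
    have h2 : (h ^ 2 + (fun x => h (x + Real.pi / 2)) ^ 2) = fun _ => R ^ 2 := funext hsq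
    rw [h2] at h1
    have h3 := h1.unique (hasDerivAt_const x _)
    simp at h3
    linarith
  have hlt : ∀ x, h x < R := fun x => by
    have := hsq x
    have := pow_pos (hpos (x + Real.pi / 2)) 2
    exact lt_of_pow_lt_pow_left₀ 2 hR.le (by linarith)
  have hR1 : ∀ x, h x / R < 1 := fun x => by rw [div_lt_one hR]; exact hlt x
  have hR0 : ∀ x, 0 < h x / R := fun x => div_pos (hpos x) hR
  have hsin : ∀ x, Real.sin (Real.arcsin (h x / R)) = h x / R := fun x =>
    Real.sin_arcsin (by linarith [hR0 x]) (hR1 x).le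
  have hcos : ∀ x, Real.cos (Real.arcsin (h x / R)) = h (x + Real.pi / 2) / R := fun x => by
    rw [Real.cos_arcsin, Real.sqrt_eq_iff_eq_sq]
    · have h1 := hsq x
      generalize h (x + Real.pi / 2) = y at h1 ⊢
      field_simp
      linarith
    · have := hR0 x; have := hR1 x; nlinarith
    · exact (hR0 _).le
  have hd : ∀ x, HasDerivAt (fun x => Real.arcsin (h x / R))
      (deriv h x / h (x + Real.pi / 2)) x := fun x => by
    have h1 := (Real.hasDerivAt_arcsin (x := h x / R) (by linarith [hR0 x])
      (hR1 x).ne).comp x ((d1 x).div_const R)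
    refine h1.congr_deriv ?_
    rw [← Real.cos_arcsin, hcos]
    have := hne x
    field_simp
  have hd' : ∀ x, HasDerivAt (fun x => deriv h x / h (x + Real.pi / 2))
      ((deriv (deriv h) x * h (x + Real.pi / 2) - deriv h x * deriv h (x + Real.pi / 2))
        / h (x + Real.pi / 2) ^ 2) x := fun x => (d2 x).div (d1q x) (hne x)
  refine ⟨_, _, ⟨hd, hd', ?_, ?_, ?_⟩, ?_, ?_, ?_⟩
  · refine Continuous.div ?_ ?_ fun x => pow_ne_zero 2 (hne x)
    · fun_prop
    · fun_prop
  · intro x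
    refine ⟨Real.arcsin_pos.2 (hR0 x), ?_⟩
    exact Real.arcsin_lt_pi_div_two.2 (hR1 x)
  · intro x
    rw [← hcos x, ← Real.sin_pi_div_two_sub, Real.arcsin_sin]
    · linarith [Real.arcsin_le_pi_div_two (h x / R)]
    · linarith [Real.arcsin_nonneg.2 (hR0 x).le]
  · intro x; rw [hsin]; field_simp
  · intro x
    rw [hcos]
    have h1 := hne x
    generalize h (x + Real.pi / 2) = y at h1 ⊢
    field_simp
  · intro x
    rw [hcos, hsin]
    have h1 := hne x
    have h2 := hcross x
    generalize h (x + Real.pi / 2) = y at h1 h2 ⊢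
    generalize deriv h (x + Real.pi / 2) = z at h2 ⊢
    field_simp
    linear_combination (deriv h x) * h2

/-- The quarter turn exchanges `cos² d` and `sin² d` and preserves `u²`. -/
theorem IsQuarterAngle.integral_cos_sq {d u v : ℝ → ℝ} (hd : IsQuarterAngle d u v) :
    ∫ x in (0 : ℝ)..2 * Real.pi, (Real.cos (d x) * u x) ^ 2 =
      1 / 2 * ∫ x in (0 : ℝ)..2 * Real.pi, u x ^ 2 := by
  have c0 := hd.continuous_angle
  have c1 := hd.continuous'
  rw [integral_two_pi_eq_half (by fun_prop)]
  · congr 1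
    refine intervalIntegral.integral_congr fun x _ => ?_
    simp only [hd.quarter, hd.quarter', Real.cos_pi_div_two_sub]
    linear_combination u x ^ 2 * Real.sin_sq_add_cos_sq (d x)
  · intro x
    have e : x + 2 * Real.pi = x + Real.pi + Real.pi := by ring
    simp only [e, hd.periodic _, hd.periodic' _]

theorem sq_integral_two_pi_le (hc : Continuous h) :
    (∫ x in (0 : ℝ)..2 * Real.pi, h x) ^ 2 ≤
      2 * Real.pi * ∫ x in (0 : ℝ)..2 * Real.pi, h x ^ 2 := by
  have hpi := Real.pi_pos
  set m := ∫ x in (0 : ℝ)..2 * Real.pi, h x with hm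
  have h1 : 0 ≤ ∫ x in (0 : ℝ)..2 * Real.pi, (2 * Real.pi * h x - m) ^ 2 :=
    intervalIntegral.integral_nonneg_of_forall (by positivity) fun x => sq_nonneg _
  have h2 : ∀ x, (2 * Real.pi * h x - m) ^ 2 =
      (2 * Real.pi) ^ 2 * h x ^ 2 - (2 * (2 * Real.pi) * m) * h x + m ^ 2 := fun x => by ring
  simp_rw [h2] at h1
  rw [intervalIntegral.integral_add (Continuous.intervalIntegrable (by fun_prop) _ _)
      (Continuous.intervalIntegrable (by fun_prop) _ _),
    intervalIntegral.integral_sub (Continuous.intervalIntegrable (by fun_prop) _ _)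
      (Continuous.intervalIntegrable (by fun_prop) _ _),
    intervalIntegral.integral_const_mul, intervalIntegral.integral_const_mul, ← hm,
    intervalIntegral.integral_const, smul_eq_mul] at h1
  have h3 : 0 ≤ (2 * Real.pi) *
      (2 * Real.pi * (∫ x in (0 : ℝ)..2 * Real.pi, h x ^ 2) - m ^ 2) := by linarith
  linarith [nonneg_of_mul_nonneg_right h3 (by positivity)]

/-- By Cauchy–Schwarz and parts the bracket on the left is at most `2π ∫ h'² = π R² ∫ u²`, while the
right side is `R² ∫ energy`. -/
theorem orthoptic_inequality (hC : ContDiff ℝ 2 h) (hpos : ∀ x, 0 < h x)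
    (hper : Function.Periodic h Real.pi) (hR : 0 < R)
    (hsq : ∀ x, h x ^ 2 + h (x + Real.pi / 2) ^ 2 = R ^ 2) :
    3 / 8 * ((∫ x in (0 : ℝ)..2 * Real.pi, h x) ^ 2
      - 2 * Real.pi * ∫ x in (0 : ℝ)..2 * Real.pi, h x * (h x + deriv (deriv h) x)) ≤
    ∫ x in (0 : ℝ)..2 * Real.pi, deriv (deriv h) x * (h x + deriv (deriv h) x)
      * wedge (Real.arcsin (h x / R)) := by
  have hpi := Real.pi_pos
  obtain ⟨u, v, hd, e0, e1, e2⟩ := exists_isQuarterAngle hC hpos hR hsq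
  set d := fun x => Real.arcsin (h x / R) with hdef
  have hC1 : ContDiff ℝ 1 (deriv h) := by
    have h' : ContDiff ℝ (1 + 1) h := by simpa [one_add_one_eq_two] using hC
    exact (contDiff_succ_iff_deriv.1 h').2.2
  have hc0 : Continuous h := hC.continuous
  have hc1 : Continuous (deriv h) := hC1.continuous
  have hc2 : Continuous (deriv (deriv h)) := hC1.continuous_deriv (by norm_num)
  have hrhs : ∫ x in (0 : ℝ)..2 * Real.pi, deriv (deriv h) x * (h x + deriv (deriv h) x)
      * wedge (Real.arcsin (h x / R)) =
      R ^ 2 * ∫ x in (0 : ℝ)..2 * Real.pi, energy (d x) (u x) (v x) := by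
    rw [← hd.integral_eq_energy, ← intervalIntegral.integral_const_mul]
    refine intervalIntegral.integral_congr fun x _ => ?_
    have t0 : h x = R * Real.sin (d x) := e0 x
    have t2 : deriv (deriv h) x = R * (Real.cos (d x) * v x - Real.sin (d x) * u x ^ 2) := e2 x
    change deriv (deriv h) x * (h x + deriv (deriv h) x) * wedge (d x) = _
    rw [t2]
    nth_rewrite 1 [t0]
    ring
  have hparts : ∫ x in (0 : ℝ)..2 * Real.pi, h x * deriv (deriv h) x =
      -∫ x in (0 : ℝ)..2 * Real.pi, deriv h x ^ 2 := by
    have hder : ∀ x, HasDerivAt (fun x => h x * deriv h x)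
        (deriv h x ^ 2 + h x * deriv (deriv h) x) x := fun x => by
      refine ((hC.differentiable (by norm_num) x).hasDerivAt.mul
        (hC1.differentiable (by norm_num) x).hasDerivAt).congr_deriv ?_
      ring
    have hint := intervalIntegral.integral_eq_sub_of_hasDerivAt (a := 0) (b := 2 * Real.pi)
      (fun x _ => hder x) (Continuous.intervalIntegrable (by fun_prop) _ _)
    rw [intervalIntegral.integral_add (Continuous.intervalIntegrable (by fun_prop) _ _)
      (Continuous.intervalIntegrable (by fun_prop) _ _)] at hint
    have p0 : h (2 * Real.pi) = h 0 := by
      rw [two_mul, hper, ← zero_add Real.pi, hper]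
    have hper' : Function.Periodic (deriv h) Real.pi := fun x => by
      rw [← deriv_comp_add_const]; congr 1; exact funext hper
    have p1 : deriv h (2 * Real.pi) = deriv h 0 := by
      rw [two_mul, hper', ← zero_add Real.pi, hper']
    rw [p0, p1, sub_self] at hint
    linarith
  have hlhs : ∫ x in (0 : ℝ)..2 * Real.pi, h x * (h x + deriv (deriv h) x) =
      (∫ x in (0 : ℝ)..2 * Real.pi, h x ^ 2) - ∫ x in (0 : ℝ)..2 * Real.pi, deriv h x ^ 2 := by
    rw [sub_eq_add_neg, ← hparts, ← intervalIntegral.integral_add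
      (Continuous.intervalIntegrable (by fun_prop) _ _)
      (Continuous.intervalIntegrable (by fun_prop) _ _)]
    refine intervalIntegral.integral_congr fun x _ => ?_
    ring
  have hder2 : ∫ x in (0 : ℝ)..2 * Real.pi, deriv h x ^ 2 =
      R ^ 2 * (1 / 2 * ∫ x in (0 : ℝ)..2 * Real.pi, u x ^ 2) := by
    rw [← hd.integral_cos_sq, ← intervalIntegral.integral_const_mul]
    refine intervalIntegral.integral_congr fun x _ => ?_
    have t1 : deriv h x = R * (Real.cos (d x) * u x) := e1 x
    rw [t1]
    ring
  rw [hrhs, hlhs, hder2]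
  have k1 := sq_integral_two_pi_le hc0
  have k2 := mul_le_mul_of_nonneg_left hd.integral_energy_ge (sq_nonneg R)
  linarith

end Orthoptic

/-! ### The chord function -/

/-- The component of the chord from the point with normal angle `x` to the one with normal angle
`y` along the tangent at `x`. -/
def chordTangent (h : ℝ → ℝ) (x y : ℝ) : ℝ :=
  h y * Real.sin (y - x) + deriv h y * Real.cos (y - x) - deriv h x

/-- The component of the same chord along the inner normal at `x`. -/
def chordNormal (h : ℝ → ℝ) (x y : ℝ) : ℝ :=
  h x - h y * Real.cos (y - x) + deriv h y * Real.sin (y - x)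

/-- The cotangent of the angle between the chord and the tangent at `x`. -/
def chordCot (h : ℝ → ℝ) (x y : ℝ) : ℝ := chordTangent h x y / chordNormal h x y

section Chord

variable {γ : ℝ → ℂ} {P : ℝ} {ψ σ : ℝ → ℝ}

theorem IsNormalParam.deriv_periodic (hp : IsNormalParam γ P ψ σ) :
    Function.Periodic (deriv (supportFunction γ)) Real.pi := fun x => by
  rw [← deriv_comp_add_const]; congr 1; exact funext hp.periodic

theorem IsNormalParam.hasDerivAt_chordNormal (hp : IsNormalParam γ P ψ σ) (x y : ℝ) :
    HasDerivAt (chordNormal (supportFunction γ) x)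
      ((supportFunction γ y + deriv (deriv (supportFunction γ)) y) * Real.sin (y - x)) y := by
  have h1 : HasDerivAt (fun y : ℝ => y - x) 1 y := (hasDerivAt_id y).sub_const x
  refine ((((hp.hasDerivAt_support y).mul h1.cos).const_sub (supportFunction γ x)).add
    ((hp.hasDerivAt_deriv y).mul h1.sin)).congr_deriv ?_
  ring

theorem IsNormalParam.hasDerivAt_chordTangent (hp : IsNormalParam γ P ψ σ) (x y : ℝ) :
    HasDerivAt (chordTangent (supportFunction γ) x)
      ((supportFunction γ y + deriv (deriv (supportFunction γ)) y) * Real.cos (y - x)) y := by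
  have h1 : HasDerivAt (fun y : ℝ => y - x) 1 y := (hasDerivAt_id y).sub_const x
  refine ((((hp.hasDerivAt_support y).mul h1.sin).add
    ((hp.hasDerivAt_deriv y).mul h1.cos)).sub_const
      (deriv (supportFunction γ) x)).congr_deriv ?_
  ring

theorem IsNormalParam.periodic_two_pi (hp : IsNormalParam γ P ψ σ) :
    Function.Periodic (supportFunction γ) (2 * Real.pi) := by
  simpa using hp.periodic.nat_mul 2

theorem IsNormalParam.deriv_periodic_two_pi (hp : IsNormalParam γ P ψ σ) :
    Function.Periodic (deriv (supportFunction γ)) (2 * Real.pi) := by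
  simpa using hp.deriv_periodic.nat_mul 2

theorem IsNormalParam.chordNormal_add_right (hp : IsNormalParam γ P ψ σ) (x y : ℝ) :
    chordNormal (supportFunction γ) x (y + 2 * Real.pi) = chordNormal (supportFunction γ) x y := by
  have e : y + 2 * Real.pi - x = y - x + 2 * Real.pi := by ring
  rw [chordNormal, chordNormal, e, Real.sin_add_two_pi, Real.cos_add_two_pi,
    hp.periodic_two_pi, hp.deriv_periodic_two_pi]

theorem IsNormalParam.chordTangent_add_right (hp : IsNormalParam γ P ψ σ) (x y : ℝ) :
    chordTangent (supportFunction γ) x (y + 2 * Real.pi) =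
      chordTangent (supportFunction γ) x y := by
  have e : y + 2 * Real.pi - x = y - x + 2 * Real.pi := by ring
  rw [chordTangent, chordTangent, e, Real.sin_add_two_pi, Real.cos_add_two_pi,
    hp.periodic_two_pi, hp.deriv_periodic_two_pi]

theorem IsNormalParam.chordCot_add_right (hp : IsNormalParam γ P ψ σ) (x y : ℝ) :
    chordCot (supportFunction γ) x (y + 2 * Real.pi) = chordCot (supportFunction γ) x y := by
  rw [chordCot, chordCot, hp.chordNormal_add_right, hp.chordTangent_add_right]

theorem IsNormalParam.chordCot_add_pi (hp : IsNormalParam γ P ψ σ) (x y : ℝ) :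
    chordCot (supportFunction γ) (x + Real.pi) (y + Real.pi) =
      chordCot (supportFunction γ) x y := by
  simp only [chordCot, chordNormal, chordTangent, hp.periodic _, hp.deriv_periodic _,
    add_sub_add_right_eq_sub]

theorem IsNormalParam.chordCot_add_two_pi (hp : IsNormalParam γ P ψ σ) (x y : ℝ) :
    chordCot (supportFunction γ) (x + 2 * Real.pi) (y + 2 * Real.pi) =
      chordCot (supportFunction γ) x y := by
  simp only [chordCot, chordNormal, chordTangent, hp.periodic_two_pi _, hp.deriv_periodic_two_pi _,
    add_sub_add_right_eq_sub]

/-- The derivative in `y` is the curvature radius times `sin (y - x)`: the function vanishes at `x`,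
rises up to `x + π`, then falls back to `0` at `x + 2π`. -/
theorem IsNormalParam.chordNormal_pos (hp : IsNormalParam γ P ψ σ) {x y : ℝ} (h1 : x < y)
    (h2 : y < x + 2 * Real.pi) : 0 < chordNormal (supportFunction γ) x y := by
  have hpi := Real.pi_pos
  have h0 : chordNormal (supportFunction γ) x x = 0 := by simp [chordNormal]
  have hc : Continuous (chordNormal (supportFunction γ) x) :=
    continuous_iff_continuousAt.2 fun y => (hp.hasDerivAt_chordNormal x y).continuousAt
  rcases le_total y (x + Real.pi) with h | h
  · have hmono : StrictMonoOn (chordNormal (supportFunction γ) x) (Icc x (x + Real.pi)) := by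
      apply strictMonoOn_of_deriv_pos (convex_Icc _ _) hc.continuousOn
      intro t ht
      rw [interior_Icc] at ht
      rw [(hp.hasDerivAt_chordNormal x t).deriv]
      exact mul_pos (hp.radius_pos t)
        (Real.sin_pos_of_pos_of_lt_pi (by linarith [ht.1]) (by linarith [ht.2]))
    have := hmono (left_mem_Icc.2 (by linarith)) ⟨h1.le, h⟩ h1
    linarith
  · have hanti : StrictAntiOn (chordNormal (supportFunction γ) x)
        (Icc (x + Real.pi) (x + 2 * Real.pi)) := by
      apply strictAntiOn_of_deriv_neg (convex_Icc _ _) hc.continuousOn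
      intro t ht
      rw [interior_Icc] at ht
      rw [(hp.hasDerivAt_chordNormal x t).deriv]
      refine mul_neg_of_pos_of_neg (hp.radius_pos t) ?_
      rw [← Real.sin_sub_two_pi]
      exact Real.sin_neg_of_neg_of_neg_pi_lt (by linarith [ht.2]) (by linarith [ht.1])
    have := hanti ⟨h, h2.le⟩ (right_mem_Icc.2 (by linarith)) h2
    rw [hp.chordNormal_add_right] at this
    linarith

/-- The twist property. The numerator in the quotient rule reduces to minus the curvature radius at
`y` times the chord's normal component seen from `y`, which is positive. -/
theorem IsNormalParam.strictAntiOn_chordCot (hp : IsNormalParam γ P ψ σ) (x : ℝ) :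
    StrictAntiOn (chordCot (supportFunction γ) x) (Ioo x (x + 2 * Real.pi)) := by
  have hder : ∀ y ∈ Ioo x (x + 2 * Real.pi), HasDerivAt (chordCot (supportFunction γ) x)
      (-((supportFunction γ y + deriv (deriv (supportFunction γ)) y)
        * chordNormal (supportFunction γ) y x) / chordNormal (supportFunction γ) x y ^ 2) y := by
    intro y hy
    refine ((hp.hasDerivAt_chordTangent x y).div (hp.hasDerivAt_chordNormal x y)
      (hp.chordNormal_pos hy.1 hy.2).ne').congr_deriv ?_
    congr 1
    have e1 : Real.sin (x - y) = -Real.sin (y - x) := by rw [← Real.sin_neg]; ring_nf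
    have e2 : Real.cos (x - y) = Real.cos (y - x) := by rw [← Real.cos_neg]; ring_nf
    simp only [chordTangent, chordNormal, e1, e2]
    linear_combination (-(supportFunction γ y + deriv (deriv (supportFunction γ)) y)
      * supportFunction γ y) * Real.sin_sq_add_cos_sq (y - x)
  apply strictAntiOn_of_deriv_neg (convex_Ioo _ _)
  · exact fun y hy => (hder y hy).continuousAt.continuousWithinAt
  · intro y hy
    rw [interior_Ioo] at hy
    rw [(hder y hy).deriv, neg_div, neg_lt_zero]
    have h1 := hp.chordNormal_pos hy.1 hy.2
    have h2 : 0 < chordNormal (supportFunction γ) y x := by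
      rw [← hp.chordNormal_add_right]
      exact hp.chordNormal_pos hy.2 (by linarith [hy.1])
    have h3 := hp.radius_pos y
    positivity

/-- The version of `strictAntiOn_chordCot` for chords arriving at `x`. -/
theorem IsNormalParam.strictAntiOn_chordCot' (hp : IsNormalParam γ P ψ σ) (x : ℝ) :
    StrictAntiOn (chordCot (supportFunction γ) x) (Ioo (x - 2 * Real.pi) x) := by
  intro a ha b hb hab
  rw [← hp.chordCot_add_right x a, ← hp.chordCot_add_right x b]
  exact hp.strictAntiOn_chordCot x ⟨by linarith [ha.1], by linarith [ha.2]⟩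
    ⟨by linarith [hb.1], by linarith [hb.2]⟩ (by linarith)

theorem IsNormalParam.continuous_chordCot (hp : IsNormalParam γ P ψ σ) {X Y : ℝ → ℝ}
    (hX : Continuous X) (hY : Continuous Y)
    (h : ∀ t, chordNormal (supportFunction γ) (X t) (Y t) ≠ 0) :
    Continuous fun t => chordCot (supportFunction γ) (X t) (Y t) := by
  have c0 := hp.continuous_support
  have c1 := hp.continuous_deriv
  unfold chordCot
  refine Continuous.div ?_ ?_ h
  · unfold chordTangent
    exact (((c0.comp hY).mul (Real.continuous_sin.comp (hY.sub hX))).add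
      ((c1.comp hY).mul (Real.continuous_cos.comp (hY.sub hX)))).sub (c1.comp hX)
  · unfold chordNormal
    exact ((c0.comp hX).sub ((c0.comp hY).mul (Real.continuous_cos.comp (hY.sub hX)))).add
      ((c1.comp hY).mul (Real.continuous_sin.comp (hY.sub hX)))

/-- The endpoint of a chord depends continuously on its starting point and angle. -/
theorem IsNormalParam.continuous_endpoint (hp : IsNormalParam γ P ψ σ) {X Y : ℝ → ℝ}
    (hX : Continuous X) (h1 : ∀ t, X t < Y t) (h2 : ∀ t, Y t < X t + 2 * Real.pi)
    (hK : Continuous fun t => chordCot (supportFunction γ) (X t) (Y t)) : Continuous Y := by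
  have hlocal : ∀ t y, X t < y → y < X t + 2 * Real.pi →
      ContinuousAt (fun r => chordCot (supportFunction γ) (X r) y) t := by
    intro t y hy1 hy2
    have c0 := hp.continuous_support
    have c1 := hp.continuous_deriv
    unfold chordCot
    refine ContinuousAt.div ?_ ?_ (hp.chordNormal_pos hy1 hy2).ne'
    · unfold chordTangent
      exact (((continuous_const.mul (Real.continuous_sin.comp (continuous_const.sub hX))).add
        (continuous_const.mul (Real.continuous_cos.comp (continuous_const.sub hX)))).sub
          (c1.comp hX)).continuousAt
    · unfold chordNormal
      exact (((c0.comp hX).sub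
        (continuous_const.mul (Real.continuous_cos.comp (continuous_const.sub hX)))).add
        (continuous_const.mul (Real.continuous_sin.comp (continuous_const.sub hX)))).continuousAt
  rw [continuous_iff_continuousAt]
  intro t
  -- Continuity of a monotone implicit function: a fixed comparison endpoint `y` on one side of `Y
  -- t` stays strictly on that side for nearby parameters.
  refine tendsto_order.2 ⟨fun a ha => ?_, fun b hb => ?_⟩
  · obtain ⟨y, hy1, hy2⟩ := exists_between (max_lt ha (h1 t))
    have hXy := (le_max_right _ _).trans_lt hy1
    have hlt : chordCot (supportFunction γ) (X t) (Y t) < chordCot (supportFunction γ) (X t) y :=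
      hp.strictAntiOn_chordCot (X t) ⟨hXy, hy2.trans (h2 t)⟩ ⟨h1 t, h2 t⟩ hy2
    filter_upwards [hK.continuousAt.eventually_lt (hlocal t y hXy (hy2.trans (h2 t))) hlt,
      hX.continuousAt.eventually_lt continuousAt_const hXy,
      continuousAt_const.eventually_lt (hX.add_const (2 * Real.pi)).continuousAt
        (hy2.trans (h2 t))] with r hr1 hr2 hr3
    by_contra hcon
    push Not at hcon
    have h3 : Y r < y := hcon.trans_lt ((le_max_left _ _).trans_lt hy1)
    exact absurd (hp.strictAntiOn_chordCot (X r) ⟨h1 r, h2 r⟩ ⟨hr2, hr3⟩ h3) (not_lt.2 hr1.le)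
  · obtain ⟨y, hy1, hy2⟩ := exists_between (lt_min hb (h2 t))
    have hXy := hy2.trans_le (min_le_right _ _)
    have hlt : chordCot (supportFunction γ) (X t) y < chordCot (supportFunction γ) (X t) (Y t) :=
      hp.strictAntiOn_chordCot (X t) ⟨h1 t, h2 t⟩ ⟨(h1 t).trans hy1, hXy⟩ hy1
    filter_upwards [(hlocal t y ((h1 t).trans hy1) hXy).eventually_lt hK.continuousAt hlt,
      hX.continuousAt.eventually_lt continuousAt_const ((h1 t).trans hy1),
      continuousAt_const.eventually_lt (hX.add_const (2 * Real.pi)).continuousAt hXy]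
      with r hr1 hr2 hr3
    by_contra hcon
    push Not at hcon
    have h3 : y < Y r := (hy2.trans_le (min_le_left _ _)).trans_le hcon
    exact absurd (hp.strictAntiOn_chordCot (X r) ⟨hr2, hr3⟩ ⟨h1 r, h2 r⟩ h3) (not_lt.2 hr1.le)

end Chord

/-! ### Families of periodic orbits of a twist recurrence -/

/-- The twist property of the chord function, for a centrally symmetric table. -/
structure IsTwist (K : ℝ → ℝ → ℝ) : Prop where
  anti : ∀ x, StrictAntiOn (K x) (Ioo x (x + 2 * Real.pi))
  anti' : ∀ x, StrictAntiOn (K x) (Ioo (x - 2 * Real.pi) x)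
  add_pi : ∀ x y, K (x + Real.pi) (y + Real.pi) = K x y

/-- The orbits of the recurrence `K x₁ x₂ + K x₁ x₀ = 0`. -/
structure IsTwistOrbit (K : ℝ → ℝ → ℝ) (x : ℤ → ℝ) : Prop where
  lt : ∀ n, x n < x (n + 1)
  lt_add : ∀ n, x (n + 1) < x n + 2 * Real.pi
  reflect : ∀ n, K (x (n + 1)) (x (n + 2)) + K (x (n + 1)) (x n) = 0

theorem add_four_mul {x : ℤ → ℝ} {c : ℝ} (hx : ∀ n, x (n + 4) = x n + c) (n k : ℤ) :
    x (n + 4 * k) = x n + k * c := by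
  induction k using Int.induction_on with
  | zero => simp
  | succ i ih =>
    rw [mul_add, mul_one, ← add_assoc, hx, ih]; push_cast; ring
  | pred i ih =>
    have := hx (n + 4 * (-(i : ℤ) - 1))
    have e : n + 4 * (-(i : ℤ) - 1) + 4 = n + 4 * (-i) := by ring
    rw [e, ih] at this
    push_cast at this ⊢
    linarith

section Twist

variable {K : ℝ → ℝ → ℝ} {x y : ℤ → ℝ}

theorem IsTwistOrbit.mem_after (hx : IsTwistOrbit K x) (n : ℤ) :
    x (n + 2) ∈ Ioo (x (n + 1)) (x (n + 1) + 2 * Real.pi) := by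
  have h1 := hx.lt (n + 1)
  have h2 := hx.lt_add (n + 1)
  rw [add_assoc, one_add_one_eq_two] at h1 h2
  exact ⟨h1, h2⟩

theorem IsTwistOrbit.mem_before (hx : IsTwistOrbit K x) (n : ℤ) :
    x n ∈ Ioo (x (n + 1) - 2 * Real.pi) (x (n + 1)) :=
  ⟨by linarith [hx.lt_add n], hx.lt n⟩

/-- At a common point both cotangents decrease in the other endpoint and sum to zero: moving the
previous point forward moves the next one backward. -/
theorem IsTwistOrbit.le_after (hK : IsTwist K) (hx : IsTwistOrbit K x) (hy : IsTwistOrbit K y)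
    {n : ℤ} (h : x (n + 1) = y (n + 1)) (hn : x n ≤ y n) : y (n + 2) ≤ x (n + 2) := by
  have h1 := (hK.anti' (x (n + 1))).le_iff_ge (h ▸ hy.mem_before n) (hx.mem_before n) |>.2 hn
  have h2 := hx.reflect n
  have h3 := hy.reflect n
  rw [← h] at h3
  exact ((hK.anti (x (n + 1))).le_iff_ge (hx.mem_after n) (h ▸ hy.mem_after n)).1 (by linarith)

theorem IsTwistOrbit.le_before (hK : IsTwist K) (hx : IsTwistOrbit K x) (hy : IsTwistOrbit K y)
    {n : ℤ} (h : x (n + 1) = y (n + 1)) (hn : x (n + 2) ≤ y (n + 2)) : y n ≤ x n := by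
  have h1 := (hK.anti (x (n + 1))).le_iff_ge (h ▸ hy.mem_after n) (hx.mem_after n) |>.2 hn
  have h2 := hx.reflect n
  have h3 := hy.reflect n
  rw [← h] at h3
  exact ((hK.anti' (x (n + 1))).le_iff_ge (hx.mem_before n) (h ▸ hy.mem_before n)).1 (by linarith)

theorem IsTwistOrbit.shift (hx : IsTwistOrbit K x) (m : ℤ) :
    IsTwistOrbit K fun n => x (n + m) where
  lt n := by have := hx.lt (n + m); rwa [add_right_comm] at this
  lt_add n := by have := hx.lt_add (n + m); rwa [add_right_comm] at this
  reflect n := by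
    have := hx.reflect (n + m)
    rwa [add_right_comm, add_right_comm n m 2] at this

theorem IsTwistOrbit.add_pi (hK : IsTwist K) (hx : IsTwistOrbit K x) :
    IsTwistOrbit K fun n => x n + Real.pi where
  lt n := by linarith [hx.lt n]
  lt_add n := by linarith [hx.lt_add n]
  reflect n := by simp only [hK.add_pi]; exact hx.reflect n

theorem IsTwistOrbit.ext (hK : IsTwist K) (hx : IsTwistOrbit K x) (hy : IsTwistOrbit K y)
    (m : ℤ) (h0 : x m = y m) (h1 : x (m + 1) = y (m + 1)) (n : ℤ) : x n = y n := by
  suffices h : ∀ n : ℤ, x (m + n) = y (m + n) ∧ x (m + n + 1) = y (m + n + 1) by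
    have := (h (n - m)).1
    rwa [add_sub_cancel] at this
  intro n
  induction n using Int.induction_on with
  | zero => simpa using ⟨h0, h1⟩
  | succ i ih =>
    rw [← add_assoc]
    refine ⟨ih.2, ?_⟩
    rw [add_assoc _ 1 1, one_add_one_eq_two]
    exact le_antisymm (hy.le_after hK hx ih.2.symm ih.1.ge) (hx.le_after hK hy ih.2 ih.1.le)
  | pred i ih =>
    have e : m + (-(i : ℤ) - 1) + 1 = m + -i := by ring
    have e2 : m + (-(i : ℤ) - 1) + 2 = m + -i + 1 := by ring
    rw [e]
    refine ⟨?_, ih.1⟩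
    have h3 : x (m + (-(i : ℤ) - 1) + 1) = y (m + (-(i : ℤ) - 1) + 1) := by rw [e]; exact ih.1
    have h4 : x (m + (-(i : ℤ) - 1) + 2) = y (m + (-(i : ℤ) - 1) + 2) := by rw [e2]; exact ih.2
    exact le_antisymm (hy.le_before hK hx h3.symm h4.ge) (hx.le_before hK hy h3 h4.le)

/-- Ordered orbits that touch coincide. -/
theorem IsTwistOrbit.eq_of_le (hK : IsTwist K) (hx : IsTwistOrbit K x) (hy : IsTwistOrbit K y)
    (hle : ∀ n, x n ≤ y n) {m : ℤ} (hm : x m = y m) (n : ℤ) : x n = y n := by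
  have h1 : x (m - 1 + 1) = y (m - 1 + 1) := by rwa [sub_add_cancel]
  have h2 := hx.le_after hK hy h1 (hle _)
  have e : m - 1 + 2 = m + 1 := by ring
  rw [e] at h2
  exact hx.ext hK hy m hm (le_antisymm (hle _) h2) n

/-- A closed curve of `4`-periodic orbits of rotation number `1/4`, lifted to the line. -/
structure IsOrbitFamily (K : ℝ → ℝ → ℝ) (X : ℤ → ℝ → ℝ) : Prop where
  orbit : ∀ t, IsTwistOrbit K fun n => X n t
  continuous : ∀ n, Continuous (X n)
  period : ∀ n t, X (n + 4) t = X n t + 2 * Real.pi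
  turn : ∀ n t, X n (t + 1) = X n t + 2 * Real.pi
  inj : ∀ t t', (∀ n, X n t = X n t') → t = t'
  shift : ∀ t, ∃ t', ∀ n, X n t' = X (n + 1) t

variable {X : ℤ → ℝ → ℝ}

theorem IsOrbitFamily.turn_int (hX : IsOrbitFamily K X) (n k : ℤ) (t : ℝ) :
    X n (t + k) = X n t + k * (2 * Real.pi) := by
  induction k using Int.induction_on with
  | zero => simp
  | succ i ih =>
    push_cast at ih ⊢
    rw [← add_assoc, hX.turn, ih]; ring
  | pred i ih =>
    have := hX.turn n (t + ((-(i : ℤ) - 1 : ℤ) : ℝ))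
    have e : t + ((-(i : ℤ) - 1 : ℤ) : ℝ) + 1 = t + ((-(i : ℤ) : ℤ) : ℝ) := by push_cast; ring
    rw [e, ih] at this
    push_cast at this ⊢
    linarith

theorem IsOrbitFamily.period_int (hX : IsOrbitFamily K X) (n k : ℤ) (t : ℝ) :
    X (n + 4 * k) t = X n t + k * (2 * Real.pi) :=
  add_four_mul (x := fun n => X n t) (fun n => hX.period n t) n k

/-- If one pair of orbits with phase difference in `(k, k + 1)` is ordered, then all are. -/
theorem IsOrbitFamily.ordered (hK : IsTwist K) (hX : IsOrbitFamily K X) {k : ℤ} {a b : ℝ}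
    (hab : (k : ℝ) < b - a) (hab' : b - a < k + 1) (h : ∀ n, X n a < X n b) {t t' : ℝ}
    (ht : (k : ℝ) < t' - t) (ht' : t' - t < k + 1) (n : ℤ) : X n t < X n t' := by
  set S : Set (ℝ × ℝ) := {p | (k : ℝ) < p.2 - p.1} ∩ {p | p.2 - p.1 < k + 1} with hS
  have hlin : IsLinearMap ℝ fun p : ℝ × ℝ => p.2 - p.1 :=
    ⟨fun p q => by simp; ring, fun c p => by simp; ring⟩
  have hpre : IsPreconnected S :=
    ((convex_halfSpace_gt hlin _).inter (convex_halfSpace_lt hlin _)).isPreconnected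
  -- By `4`-periodicity four indices decide the order, so being ordered is an open condition. It is
  -- also closed in the strip, since touching ordered orbits coincide and `inj` then forces `t =
  -- t'`, which the strip excludes.
  set U : Set (ℝ × ℝ) := ⋂ i ∈ Finset.range 4, {p | X i p.1 < X i p.2} with hU
  have hUmem : ∀ p, p ∈ U ↔ ∀ n, X n p.1 < X n p.2 := by
    intro p
    simp only [hU, mem_iInter, Finset.mem_range]
    constructor
    · intro hp n
      have e : n = ((n % 4).toNat : ℤ) + 4 * (n / 4) := by
        rw [Int.toNat_of_nonneg (Int.emod_nonneg _ (by norm_num)), Int.emod_add_mul_ediv]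
      have hlt : (n % 4).toNat < 4 := by omega
      have := hp _ hlt
      rw [e, hX.period_int, hX.period_int]
      have h' : X ((n % 4).toNat : ℤ) p.1 < X ((n % 4).toNat : ℤ) p.2 := this
      linarith
    · intro hp i _
      exact hp i
  have hopen : IsOpen U := by
    refine isOpen_biInter_finset fun i _ => ?_
    exact isOpen_lt ((hX.continuous i).comp continuous_fst) ((hX.continuous i).comp continuous_snd)
  have hcl : closure U ∩ S ⊆ U := by
    rintro p ⟨hpU, hpS⟩
    have hle : ∀ n, X n p.1 ≤ X n p.2 := by
      intro n
      have hclosed : IsClosed {p : ℝ × ℝ | X n p.1 ≤ X n p.2} :=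
        isClosed_le ((hX.continuous n).comp continuous_fst)
          ((hX.continuous n).comp continuous_snd)
      exact closure_minimal (fun q hq => ((hUmem q).1 hq n).le) hclosed hpU
    rw [hUmem]
    intro n
    refine (hle n).lt_of_ne fun heq => ?_
    have hall := (hX.orbit p.1).eq_of_le hK (hX.orbit p.2) hle heq
    have := hX.inj _ _ hall
    have h1 : (k : ℝ) < p.2 - p.1 := hpS.1
    have h2 : p.2 - p.1 < k + 1 := hpS.2
    rw [this, sub_self] at h1 h2
    have h3 : k < 0 := by exact_mod_cast h1
    have h4 : (-1 : ℝ) < k := by linarith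
    have h5 : -1 < k := by exact_mod_cast h4
    omega
  have hsub := hpre.subset_of_closure_inter_subset hopen
    ⟨(a, b), ⟨hab, hab'⟩, (hUmem _).2 h⟩ hcl
  exact (hUmem _).1 (hsub (show (t, t') ∈ S from ⟨ht, ht'⟩)) n

/-- The parameter `t'` of the image of orbit `0` provides ordered pairs `(0, t')` and `(t', 1)`;
connectedness of a strip of parameter differences spreads the order from either one. -/
theorem IsOrbitFamily.strictMono (hK : IsTwist K) (hX : IsOrbitFamily K X) (n : ℤ) :
    StrictMono (X n) := by
  have hpi := Real.pi_pos
  obtain ⟨t', ht'⟩ := hX.shift 0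
  have hlt : ∀ n, X n 0 < X n t' := fun n => by rw [ht']; exact (hX.orbit 0).lt n
  have hlt' : ∀ n, X n t' < X n (0 + 1) := fun n => by
    rw [ht', hX.turn]; exact (hX.orbit 0).lt_add n
  -- `t'` is not an integer: otherwise its orbit would be a whole number of turns from orbit `0`,
  -- yet it lies strictly within the first turn.
  set k : ℤ := ⌊t'⌋ with hk
  have hk1 : (k : ℝ) ≤ t' := Int.floor_le _
  have hk2 : t' < k + 1 := Int.lt_floor_add_one _
  have hk3 : (k : ℝ) < t' := by
    refine hk1.lt_of_ne fun heq => ?_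
    have h1 := hlt 0
    have h2 := hlt' 0
    have h3 := hX.turn_int 0 k 0
    rw [zero_add, heq] at h3
    rw [hX.turn] at h2
    rw [h3] at h1 h2
    have h4 : (0 : ℝ) < t' := by
      by_contra hc
      push Not at hc
      nlinarith
    have h5 : t' < 1 := by
      by_contra hc
      push Not at hc
      nlinarith
    rw [← heq] at h4 h5
    have h6 : 0 < k := by exact_mod_cast h4
    have h7 : k < 1 := by exact_mod_cast h5
    omega
  -- The pair `(0, t')` gives the strip with index `k`, the pair `(t', 1)` the one with index `-k`.
  -- An index `m ≤ 0` is wanted, so that translating back by `m` turns preserves the inequality.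
  obtain ⟨m, hm0, hm⟩ : ∃ m : ℤ, m ≤ 0 ∧ ∀ t t' : ℝ, (m : ℝ) < t' - t → t' - t < m + 1 →
      ∀ n, X n t < X n t' := by
    rcases le_total k 0 with h | h
    · exact ⟨k, h, fun t s h1 h2 => hX.ordered hK (by simpa using hk3) (by simpa using hk2) hlt
        h1 h2⟩
    · refine ⟨-k, by omega, fun t s h1 h2 => hX.ordered hK (a := t') (b := 0 + 1) ?_ ?_ hlt' h1 h2⟩
      · push_cast; linarith
      · push_cast; linarith
  have hsmall : ∀ s t : ℝ, s < t → t < s + 1 → X n s < X n t := by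
    intro s t h1 h2
    have h3 := hm s (t + m) (by linarith) (by linarith) n
    rw [hX.turn_int] at h3
    have h4 : (m : ℝ) ≤ 0 := by exact_mod_cast hm0
    nlinarith
  intro s t hst
  set j : ℤ := ⌊t - s⌋ with hj
  have hj1 : (j : ℝ) ≤ t - s := Int.floor_le _
  have hj2 : t - s < j + 1 := Int.lt_floor_add_one _
  have hj0 : 0 ≤ j := Int.floor_nonneg.2 (by linarith)
  have hj0' : (0 : ℝ) ≤ j := by exact_mod_cast hj0
  have e : t = (t - j) + j := by ring
  rw [e, hX.turn_int]
  rcases (show s ≤ t - j by linarith).eq_or_lt with h | h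
  · rw [← h]
    have : (0 : ℝ) < j := by linarith
    nlinarith
  · have := hsmall s (t - j) h (by linarith)
    nlinarith

theorem IsOrbitFamily.surjective (hX : IsOrbitFamily K X) (n : ℤ) :
    Function.Surjective (X n) :=
  surjective_of_add_eq (hX.continuous n) one_pos (by positivity) (hX.turn n)

theorem IsOrbitFamily.add_pi (hK : IsTwist K) (hX : IsOrbitFamily K X) :
    IsOrbitFamily K fun n t => X n t + Real.pi where
  orbit t := (hX.orbit t).add_pi hK
  continuous n := (hX.continuous n).add_const _
  period n t := by rw [hX.period]; ring
  turn n t := by rw [hX.turn]; ring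
  inj t t' h := hX.inj t t' fun n => by linarith [h n]
  shift t := by
    obtain ⟨t', ht'⟩ := hX.shift t
    exact ⟨t', fun n => by rw [ht']⟩

theorem IsOrbitFamily.shift_int (hX : IsOrbitFamily K X) (t : ℝ) (m : ℤ) :
    ∃ t', ∀ n, X n t' = X (n + m) t := by
  have key : ∀ m : ℕ, ∃ t', ∀ n, X n t' = X (n + m) t := by
    intro m
    induction m with
    | zero => exact ⟨t, fun n => by simp⟩
    | succ i ih =>
      obtain ⟨r, hr⟩ := ih
      obtain ⟨r', hr'⟩ := hX.shift r
      exact ⟨r', fun n => by rw [hr', hr]; congr 1; push_cast; ring⟩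
  obtain ⟨r, hr⟩ := key (m % 4).toNat
  refine ⟨r + ((m / 4 : ℤ) : ℝ), fun n => ?_⟩
  have e : n + m = n + ((m % 4).toNat : ℤ) + 4 * (m / 4) := by
    rw [Int.toNat_of_nonneg (Int.emod_nonneg _ (by norm_num)), add_assoc, Int.emod_add_mul_ediv]
  rw [e, hX.period_int, hX.turn_int, hr]

/-- Two families of `4`-periodic orbits: if the second family lags behind the first one at some
point then this is so along the whole orbit, which contradicts periodicity. -/
theorem IsOrbitFamily.le_of_eq {Y : ℤ → ℝ → ℝ} (hK : IsTwist K) (hX : IsOrbitFamily K X)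
    (hY : IsOrbitFamily K Y) {s t : ℝ} (h0 : X 0 s = Y 0 t) : X 1 s ≤ Y 1 t := by
  by_contra hlt
  push Not at hlt
  -- If `Y` lags behind `X` when leaving `X n s`, then the `Y`-orbit through `X (n + 1) s` comes
  -- from beyond `X n s`; reflection reverses this order, so `Y` lags again.
  have step : ∀ (n : ℕ) (r : ℝ), Y 0 r = X n s → Y 1 r < X (n + 1) s →
      ∃ r', Y 0 r' = X (n + 1) s ∧ Y 1 r' < X (n + 2) s ∧ Y 1 r < Y 0 r' := by
    intro n r h1 h2
    obtain ⟨r', hr'⟩ := hY.surjective 0 (X (n + 1) s)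
    obtain ⟨q, hq⟩ := hY.shift_int r' (-1)
    have hq0 : Y 0 q = Y (-1) r' := by rw [hq]; rfl
    have hq1 : Y 1 q = Y 0 r' := by rw [hq]; rfl
    have hrq : r < q := by
      rw [← (hY.strictMono hK 1).lt_iff_lt, hq1, hr']; exact h2
    have h3 : X n s < Y (-1) r' := by
      rw [← h1, ← hq0]; exact hY.strictMono hK 0 hrq
    have oX := (hX.orbit s).shift n
    have oY := (hY.orbit r').shift (-1)
    have e1 : X (0 + 1 + n) s = Y (0 + 1 + -1) r' := by
      have : (0 : ℤ) + 1 + n = n + 1 := by ring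
      rw [this]; exact hr'.symm
    have h4 := oX.le_after hK oY e1 (by
      have : (0 : ℤ) + n = n := by ring
      simp only [this]; exact h3.le)
    have h5 : Y 1 r' ≤ X (n + 2) s := by
      have a1 : (0 : ℤ) + 2 + n = n + 2 := by ring
      have a2 : (0 : ℤ) + 2 + -1 = 1 := by ring
      simp only [a1, a2] at h4
      exact h4
    refine ⟨r', hr', h5.lt_of_ne fun heq => ?_, by rw [hr']; exact h2⟩
    have h6 := oX.le_before hK oY e1 (by
      have a1 : (0 : ℤ) + 2 + n = n + 2 := by ring
      have a2 : (0 : ℤ) + 2 + -1 = 1 := by ring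
      simp only [a1, a2]; exact heq.ge)
    have a1 : (0 : ℤ) + n = n := by ring
    simp only [a1] at h6
    exact absurd h3 (not_lt.2 h6)
  have mono1 := hY.strictMono hK
  obtain ⟨r1, a1, b1, c1⟩ := step 0 t h0.symm (by simpa using hlt)
  obtain ⟨r2, a2, b2, c2⟩ := step 1 r1 (by simpa using a1) (by simpa using b1)
  obtain ⟨r3, a3, b3, c3⟩ := step 2 r2 (by simpa using a2) (by simpa using b2)
  obtain ⟨r4, a4, -, c4⟩ := step 3 r3 (by simpa using a3) (by simpa using b3)
  -- Since one step of `Y` preserves order, the four lags add up to `Y 4 t < X 4 s`, whereas both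
  -- equal the common starting point plus `2π`.
  obtain ⟨q1, hq1⟩ := hY.shift_int t 1
  obtain ⟨q2, hq2⟩ := hY.shift_int t 2
  obtain ⟨q3, hq3⟩ := hY.shift_int t 3
  have d1 : q1 < r1 := by
    rw [← (mono1 0).lt_iff_lt, hq1]; exact c1
  have d2 : q2 < r2 := by
    rw [← (mono1 0).lt_iff_lt]
    refine lt_trans ?_ c2
    have := mono1 1 d1
    rw [hq1] at this
    rw [hq2]; exact this
  have d3 : q3 < r3 := by
    rw [← (mono1 0).lt_iff_lt]
    refine lt_trans ?_ c3
    have := mono1 1 d2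
    rw [hq2] at this
    rw [hq3]; exact this
  have d4 : Y 4 t < Y 0 r4 := by
    refine lt_trans ?_ c4
    have := mono1 1 d3
    rw [hq3] at this
    exact this
  rw [a4] at d4
  have p1 := hX.period 0 s
  have p2 := hY.period 0 t
  norm_num at d4 p1 p2
  linarith

/-- The orbits of a family are centrally symmetric. -/
theorem IsOrbitFamily.two_eq (hK : IsTwist K) (hX : IsOrbitFamily K X) (t : ℝ) :
    X 2 t = X 0 t + Real.pi := by
  have hsym : ∀ s t : ℝ, X 0 s = X 0 t + Real.pi → X 1 s = X 1 t + Real.pi := fun s t h =>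
    le_antisymm (hX.le_of_eq hK (hX.add_pi hK) h) ((hX.add_pi hK).le_of_eq hK hX h.symm)
  -- The central symmetry maps the family into itself. It remains to compare it with the two-step
  -- shift: both are order-preserving and square to a full turn, so neither can exceed the other.
  have hall : ∀ s t : ℝ, X 0 s = X 0 t + Real.pi → ∀ n, X n s = X n t + Real.pi := fun s t h =>
    (hX.orbit s).ext hK ((hX.orbit t).add_pi hK) 0 h (hsym s t h)
  obtain ⟨s, hs⟩ := hX.surjective 0 (X 0 t + Real.pi)
  have hs' := hall s t hs
  obtain ⟨r, hr⟩ := hX.shift_int t 2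
  have hr0 : X 0 r = X 2 t := by rw [hr]; rfl
  have hr2 : X 2 r = X 0 t + 2 * Real.pi := by
    rw [hr, ← hX.period]; rfl
  rw [← hr0, ← hs]
  have h2s : X 2 s = X 0 r + Real.pi := by rw [hs', hr0]
  have h2r : X 2 r = X 0 s + Real.pi := by rw [hr2, hs]; ring
  rcases lt_trichotomy r s with h | h | h
  · have := hX.strictMono hK 2 h
    have h' := hX.strictMono hK 0 h
    linarith
  · rw [h]
  · have := hX.strictMono hK 2 h
    have h' := hX.strictMono hK 0 h
    linarith

end Twist

/-! ### The invariant curve of a table -/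

section Curve

variable {γ : ℝ → ℂ} {P : ℝ} {ψ σ : ℝ → ℝ}

theorem IsNormalParam.isTwist (hp : IsNormalParam γ P ψ σ) :
    IsTwist (chordCot (supportFunction γ)) :=
  ⟨hp.strictAntiOn_chordCot, hp.strictAntiOn_chordCot', hp.chordCot_add_pi⟩

theorem IsNormalParam.continuous_angle (hp : IsNormalParam γ P ψ σ) : Continuous ψ :=
  (hp.strictMono.orderIsoOfSurjective ψ fun x => ⟨σ x, hp.right_inv x⟩).continuous

theorem eq_of_cos_div_sin_eq {a b : ℝ} (ha : a ∈ Ioo 0 Real.pi) (hb : b ∈ Ioo 0 Real.pi)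
    (h : Real.cos a / Real.sin a = Real.cos b / Real.sin b) : a = b := by
  have h1 := Real.sin_pos_of_mem_Ioo ha
  have h2 := Real.sin_pos_of_mem_Ioo hb
  rw [div_eq_div_iff h1.ne' h2.ne'] at h
  have h3 : Real.sin (a - b) = 0 := by rw [Real.sin_sub]; linarith
  have := (Real.sin_eq_zero_iff_of_lt_of_lt (by linarith [ha.1, hb.2])
    (by linarith [ha.2, hb.1])).1 h3
  linarith

/-- The chord of a step in the frame at its starting point. -/
theorem IsNormalParam.chord_eq (hp : IsNormalParam γ P ψ σ) {s t L δ : ℝ}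
    (h : γ t - γ s = L * (Complex.exp (δ * Complex.I) * deriv γ s)) :
    chordTangent (supportFunction γ) (ψ s) (ψ t) = L * Real.cos δ ∧
      chordNormal (supportFunction γ) (ψ s) (ψ t) = L * Real.sin δ := by
  have hs := hp.left_inv s
  have ht := hp.left_inv t
  generalize ψ s = x at hs ⊢
  generalize ψ t = y at ht ⊢
  subst hs ht
  rw [hp.tangent, hp.right_inv] at h
  have hre := congrArg Complex.re h
  have him := congrArg Complex.im h
  rw [Complex.sub_re, hp.re, hp.re] at hre
  rw [Complex.sub_im, hp.im, hp.im] at him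
  simp [Complex.exp_ofReal_mul_I_re, Complex.exp_ofReal_mul_I_im] at hre him
  have hcs := Real.sin_sq_add_cos_sq x
  rw [chordTangent, chordNormal, Real.sin_sub, Real.cos_sub]
  constructor
  · linear_combination (-Real.sin x) * hre + Real.cos x * him
      + (L * Real.cos δ + deriv (supportFunction γ) x) * hcs
  · linear_combination (-Real.cos x) * hre - Real.sin x * him
      + (L * Real.sin δ - supportFunction γ x) * hcs

/-- The cotangents are the chord components in the frames at its two ends. Equating the two
expressions for the chord's direction gives `ψ₁ - ψ = δ + δ₁` modulo `2π`, and both sides lie in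
`(0, 2π)`. -/
theorem IsNormalParam.step (hp : IsNormalParam γ P ψ σ) {z z₁ : ℝ × ℝ}
    (h : Step γ P z z₁) :
    ψ z.1 < ψ z₁.1 ∧ ψ z₁.1 < ψ z.1 + 2 * Real.pi ∧
      chordCot (supportFunction γ) (ψ z.1) (ψ z₁.1) = Real.cos z.2 / Real.sin z.2 ∧
      chordCot (supportFunction γ) (ψ z₁.1) (ψ z.1) = -(Real.cos z₁.2 / Real.sin z₁.2) ∧
      ψ z₁.1 - ψ z.1 = z.2 + z₁.2 := by
  obtain ⟨hz, hz₁, h1, h2, h3, h4⟩ := h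
  have l1 := hp.strictMono h1
  have l2 := hp.strictMono h2
  rw [hp.angle_add] at l2
  obtain ⟨t1, n1⟩ := hp.chord_eq h3
  obtain ⟨t2, n2⟩ := hp.chord_eq (s := z₁.1) (t := z.1) (L := -‖γ z₁.1 - γ z.1‖) (δ := -z₁.2)
    (by
      have h5 := congrArg Neg.neg h4
      rw [neg_sub] at h5
      rw [h5]
      push_cast
      rw [neg_mul (z₁.2 : ℂ)]
      ring)
  have hs := Real.sin_pos_of_mem_Ioo hz
  have hpos := hp.chordNormal_pos l1 l2
  have hL : ‖γ z₁.1 - γ z.1‖ ≠ 0 := by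
    intro h0
    rw [n1, h0, zero_mul] at hpos
    exact lt_irrefl _ hpos
  refine ⟨l1, l2, ?_, ?_, ?_⟩
  · rw [chordCot, t1, n1, mul_div_mul_left _ _ hL]
  · rw [chordCot, t2, n2, mul_div_mul_left _ _ (neg_ne_zero.2 hL), Real.cos_neg, Real.sin_neg,
      div_neg]
  · have e : Complex.exp (z.2 * Complex.I) * deriv γ z.1 =
        Complex.exp (-(z₁.2 * Complex.I)) * deriv γ z₁.1 := by
      have hL' : (‖γ z₁.1 - γ z.1‖ : ℂ) ≠ 0 := by exact_mod_cast hL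
      exact mul_left_cancel₀ hL' (h3.symm.trans h4)
    rw [hp.tangent, hp.tangent] at e
    have e2 : Complex.exp ((ψ z₁.1 - ψ z.1 - (z.2 + z₁.2) : ℝ) * Complex.I) = 1 := by
      have e3 : Complex.exp (z.2 * Complex.I) * Complex.exp (ψ z.1 * Complex.I) =
          Complex.exp (-(z₁.2 * Complex.I)) * Complex.exp (ψ z₁.1 * Complex.I) := by
        apply mul_left_cancel₀ Complex.I_ne_zero
        linear_combination e
      rw [← Complex.exp_add, ← Complex.exp_add] at e3
      have e4 : ((ψ z₁.1 - ψ z.1 - (z.2 + z₁.2) : ℝ) : ℂ) * Complex.I =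
          (-(z₁.2 * Complex.I) + ψ z₁.1 * Complex.I)
            - (z.2 * Complex.I + ψ z.1 * Complex.I) := by push_cast; ring
      rw [e4, Complex.exp_sub, e3, div_self (Complex.exp_ne_zero _)]
    have e5 := congrArg Complex.re e2
    rw [Complex.exp_ofReal_mul_I_re, Complex.one_re, Real.cos_eq_one_iff_of_lt_of_lt
      (by linarith [hz.2, hz₁.2]) (by linarith [hz.1, hz₁.1])] at e5
    linarith

/-- A step is determined by its starting line. -/
theorem IsNormalParam.step_unique (hp : IsNormalParam γ P ψ σ)
    {z z₁ w w₁ : ℝ × ℝ} (hz : Step γ P z z₁) (hw : Step γ P w w₁) {k : ℝ}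
    (h1 : ψ w.1 = ψ z.1 + k) (h2 : w.2 = z.2)
    (hk : ∀ x y, chordCot (supportFunction γ) (x + k) (y + k) = chordCot (supportFunction γ) x y) :
    ψ w₁.1 = ψ z₁.1 + k := by
  obtain ⟨a1, a2, a3, -⟩ := hp.step hz
  obtain ⟨b1, b2, b3, -⟩ := hp.step hw
  rw [h2, h1, ← a3, ← hk (ψ z.1) (ψ z₁.1)] at b3
  rw [h1] at b1 b2
  exact (hp.strictAntiOn_chordCot (ψ z.1 + k)).injOn ⟨b1, b2⟩ ⟨by linarith, by linarith⟩ b3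

theorem IsNormalParam.isTwistOrbit (hp : IsNormalParam γ P ψ σ)
    {z : ℤ → ℝ × ℝ} (hz : IsOrbit γ P z) :
    IsTwistOrbit (chordCot (supportFunction γ)) fun n => ψ (z n).1 where
  lt n := (hp.step (hz n)).1
  lt_add n := (hp.step (hz n)).2.1
  reflect n := by
    have h1 := (hp.step (hz n)).2.2.2.1
    have h2 := (hp.step (hz (n + 1))).2.2.1
    rw [add_assoc, one_add_one_eq_two] at h2
    rw [h1, h2, add_neg_cancel]

/-- Along multiples of four the quotient is constantly `k / 4`, so the rotation number fixes the
winding of the period. -/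
theorem period_eq_one (hγ : IsTable γ P) {z : ℤ → ℝ × ℝ} {k : ℤ}
    (hk : ∀ n, z (n + 4) = z n + (k * P, 0))
    (hlim : Tendsto (fun n : ℕ => ((z n).1 - (z 0).1) / (n * P)) atTop (𝓝 (1 / 4))) : k = 1 := by
  have hP := hγ.pos
  have h1 : ∀ m : ℕ, (z ((4 * (m + 1) : ℕ) : ℤ)).1 = (z 0).1 + (m + 1) * (k * P) := by
    intro m
    have h2 := add_four_mul (x := fun n => (z n).1) (c := k * P) (fun n => by simp [hk]) 0
      ((m + 1 : ℕ) : ℤ)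
    rw [zero_add] at h2
    push_cast at h2 ⊢
    exact h2
  have h2 : Tendsto (fun m : ℕ => 4 * (m + 1)) atTop atTop :=
    tendsto_atTop_mono (fun m => by omega : ∀ m : ℕ, m ≤ 4 * (m + 1)) tendsto_id
  have h3 := hlim.comp h2
  have h4 : ((fun n : ℕ => ((z n).1 - (z 0).1) / (n * P)) ∘ fun m : ℕ => 4 * (m + 1))
      = fun _ => (k : ℝ) / 4 := by
    ext m
    simp only [Function.comp]
    rw [h1]
    push_cast
    field_simp
    ring
  rw [h4] at h3
  have h5 := tendsto_nhds_unique h3 tendsto_const_nhds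
  have h6 : (k : ℝ) = 1 := by linarith
  exact_mod_cast h6

/-- An invariant curve of `4`-periodic orbits gives a family of twist orbits. -/
theorem IsNormalParam.isOrbitFamily (hp : IsNormalParam γ P ψ σ)
    {c : ℝ → ℝ × ℝ} (hc : Continuous c) (hcP : ∀ t, c (t + 1) = c t + (P, 0))
    (hinj : ∀ t t' : ℝ, ∀ k : ℤ, c t' = c t + (k * P, 0) → t' = t + k)
    {z : ℝ → ℤ → ℝ × ℝ} (hz : ∀ t, IsOrbit γ P (z t)) (hz0 : ∀ t, z t 0 = c t)
    (hzc : ∀ t n, z t n ∈ range c) (hper : ∀ t n, z t (n + 4) = z t n + (P, 0)) :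
    IsOrbitFamily (chordCot (supportFunction γ)) fun n t => ψ (z t n).1 := by
  have hK := hp.isTwist
  have horb : ∀ t, IsTwistOrbit (chordCot (supportFunction γ)) fun n => ψ (z t n).1 := fun t =>
    hp.isTwistOrbit (hz t)
  have hperiod : ∀ n t, ψ (z t (n + 4)).1 = ψ (z t n).1 + 2 * Real.pi := fun n t => by
    rw [hper, Prod.fst_add, hp.angle_add]
  -- Point and cotangent are carried together: the cotangent at one end determines the next point
  -- continuously, and the chord then determines the cotangent there. Negative indices follow by
  -- periodicity.
  have hnat : ∀ n : ℕ, Continuous (fun t => ψ (z t n).1) ∧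
      Continuous fun t => Real.cos (z t n).2 / Real.sin (z t n).2 := by
    intro n
    induction n with
    | zero =>
      simp only [Nat.cast_zero, hz0]
      refine ⟨hp.continuous_angle.comp (continuous_fst.comp hc), Continuous.div
        (Real.continuous_cos.comp (continuous_snd.comp hc))
        (Real.continuous_sin.comp (continuous_snd.comp hc)) fun t => ?_⟩
      have := (hz t 0).1
      rw [hz0] at this
      exact (Real.sin_pos_of_mem_Ioo this).ne'
    | succ i ih =>
      have st := fun t => hp.step (hz t i)
      have h1 : Continuous fun t => ψ (z t (i + 1)).1 := by
        refine hp.continuous_endpoint ih.1 (fun t => (st t).1) (fun t => (st t).2.1) ?_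
        simp only [fun t => (st t).2.2.1]
        exact ih.2
      push_cast
      refine ⟨h1, ?_⟩
      have h2 : (fun t => Real.cos (z t (i + 1)).2 / Real.sin (z t (i + 1)).2) = fun t =>
          -chordCot (supportFunction γ) (ψ (z t (i + 1)).1) (ψ (z t i).1) := by
        ext t; rw [(st t).2.2.2.1, neg_neg]
      rw [h2]
      refine (hp.continuous_chordCot h1 ih.1 fun t => ?_).neg
      rw [← hp.chordNormal_add_right]
      exact (hp.chordNormal_pos (st t).2.1 (by linarith [(st t).1])).ne'
  refine ⟨horb, fun n => ?_, hperiod, ?_, ?_, ?_⟩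
  · have e : (fun t => ψ (z t n).1) = fun t => ψ (z t (n % 4).toNat).1 +
        ((n / 4 : ℤ) : ℝ) * (2 * Real.pi) := by
      ext t
      have h1 := add_four_mul (x := fun n => ψ (z t n).1) (fun n => hperiod n t)
        ((n % 4).toNat : ℤ) (n / 4)
      have h2 : ((n % 4).toNat : ℤ) + 4 * (n / 4) = n := by
        rw [Int.toNat_of_nonneg (Int.emod_nonneg _ (by norm_num)), Int.emod_add_mul_ediv]
      rw [h2] at h1
      exact h1
    rw [e]
    exact (hnat _).1.add continuous_const
  · intro n t
    have h0 : ψ (z (t + 1) 0).1 = ψ (z t 0).1 + 2 * Real.pi := by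
      rw [hz0, hz0, hcP, Prod.fst_add, hp.angle_add]
    have h1 : ψ (z (t + 1) (0 + 1)).1 = ψ (z t (0 + 1)).1 + 2 * Real.pi :=
      hp.step_unique (hz t 0) (hz (t + 1) 0) h0 (by rw [hz0, hz0, hcP]; simp)
        hp.chordCot_add_two_pi
    have := (horb (t + 1)).ext hK (((horb t).add_pi hK).add_pi hK) 0
      (by simp only [h0]; ring) (by simp only [h1]; ring) n
    rw [this]; ring
  · intro t t' h
    have h0 := h 0
    have h1 := h 1
    have s1 := hp.step (hz t 0)
    have s2 := hp.step (hz t' 0)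
    rw [zero_add] at s1 s2
    have h2 := eq_of_cos_div_sin_eq (hz t 0).1 (hz t' 0).1
      (by rw [← s1.2.2.1, ← s2.2.2.1, h0, h1])
    have h3 := hp.strictMono.injective h0
    have h4 := hinj t' t 0 (by
      rw [← hz0, ← hz0]
      ext <;> simp [h2, h3])
    simpa using h4
  · intro t
    obtain ⟨t', ht'⟩ := hzc t 1
    refine ⟨t', fun n => ?_⟩
    have h0 : z t' 0 = z t 1 := by rw [hz0, ht']
    have h1 : ψ (z t' (0 + 1)).1 = ψ (z t (1 + 1)).1 + 0 :=
      hp.step_unique (hz t 1) (hz t' 0) (by rw [h0, add_zero]) (by rw [h0]) (by simp)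
    exact (horb t').ext hK ((horb t).shift 1) 0 (by simp [h0]) (by simpa using h1) n

/-- On a family of steps of a table, consecutive normals are orthogonal. -/
theorem IsNormalParam.quarter (hp : IsNormalParam γ P ψ σ)
    {z : ℝ → ℤ → ℝ × ℝ} (hz : ∀ t, IsOrbit γ P (z t))
    (hX : IsOrbitFamily (chordCot (supportFunction γ)) fun n t => ψ (z t n).1) (t : ℝ) :
    ψ (z t 1).1 = ψ (z t 0).1 + Real.pi / 2 := by
  have hK := hp.isTwist
  have h2 : ψ (z t 2).1 = ψ (z t 0).1 + Real.pi := hX.two_eq hK t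
  have h3 : ψ (z t 3).1 = ψ (z t 1).1 + Real.pi := by
    obtain ⟨t', ht'⟩ := hX.shift t
    have := hX.two_eq hK t'
    rw [ht', ht'] at this
    exact this
  have s0 := hp.step (hz t 0)
  have s1 := hp.step (hz t 1)
  have s2 := hp.step (hz t 2)
  norm_num at s0 s1 s2
  -- Opposite sides of the quadrilateral are exchanged by the central symmetry, so `δ₂ = δ₀`. The
  -- two normal increments `δ₀ + δ₁` and `δ₁ + δ₂` are then equal and sum to `π`.
  have e : (z t 2).2 = (z t 0).2 := by
    apply eq_of_cos_div_sin_eq (hz t 2).1 (hz t 0).1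
    rw [← s0.2.2.1, ← s2.2.2.1, h2, h3, hp.chordCot_add_pi]
  have a0 := s0.2.2.2.2
  have a1 := s1.2.2.2.2
  rw [e] at a1
  linarith

theorem chordCot_quarter (γ : ℝ → ℂ) (x : ℝ) :
    chordCot (supportFunction γ) x (x + Real.pi / 2) =
      (supportFunction γ (x + Real.pi / 2) - deriv (supportFunction γ) x) /
        (supportFunction γ x + deriv (supportFunction γ) (x + Real.pi / 2)) := by
  simp [chordCot, chordTangent, chordNormal]

theorem IsNormalParam.chordCot_quarter' (hp : IsNormalParam γ P ψ σ) (x : ℝ) :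
    chordCot (supportFunction γ) x (x - Real.pi / 2) =
      (-supportFunction γ (x + Real.pi / 2) - deriv (supportFunction γ) x) /
        (supportFunction γ x - deriv (supportFunction γ) (x + Real.pi / 2)) := by
  have e : x + Real.pi / 2 = x - Real.pi / 2 + Real.pi := by ring
  rw [e, hp.periodic, hp.deriv_periodic]
  simp [chordCot, chordTangent, chordNormal, sub_eq_add_neg]

/-- The quarter-turn condition on the support function. -/
theorem IsNormalParam.cross_eq_zero (hp : IsNormalParam γ P ψ σ) {x : ℝ}
    (h : chordCot (supportFunction γ) x (x + Real.pi / 2)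
      + chordCot (supportFunction γ) x (x - Real.pi / 2) = 0) :
    supportFunction γ x * deriv (supportFunction γ) x +
      supportFunction γ (x + Real.pi / 2) * deriv (supportFunction γ) (x + Real.pi / 2) = 0 ∧
    chordCot (supportFunction γ) x (x + Real.pi / 2) =
      supportFunction γ (x + Real.pi / 2) / supportFunction γ x := by
  have hpi := Real.pi_pos
  have n1 := hp.chordNormal_pos (x := x) (y := x + Real.pi / 2) (by linarith) (by linarith)
  have n2 := hp.chordNormal_pos (x := x) (y := x - Real.pi / 2 + 2 * Real.pi) (by linarith)
    (by linarith)
  rw [hp.chordNormal_add_right] at n2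
  have e : x + Real.pi / 2 = x - Real.pi / 2 + Real.pi := by ring
  have e1 : supportFunction γ (x - Real.pi / 2) = supportFunction γ (x + Real.pi / 2) := by
    rw [e, hp.periodic]
  have e2 : deriv (supportFunction γ) (x - Real.pi / 2) =
      deriv (supportFunction γ) (x + Real.pi / 2) := by rw [e, hp.deriv_periodic]
  simp [chordNormal] at n1
  simp [chordNormal, sub_eq_add_neg] at n2
  rw [← sub_eq_add_neg, e2] at n2
  replace n2 := sub_pos.2 n2
  have hpos := hp.pos x
  rw [chordCot_quarter, hp.chordCot_quarter'] at h
  have key : supportFunction γ x * deriv (supportFunction γ) x +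
      supportFunction γ (x + Real.pi / 2) * deriv (supportFunction γ) (x + Real.pi / 2) = 0 := by
    -- The numerator of the sum of the two cotangents is `-2` times the required expression; the
    -- denominators are positive normal components.
    rw [div_add_div _ _ n1.ne' n2.ne', div_eq_zero_iff] at h
    rcases h with h | h
    · linear_combination (-1 / 2) * h
    · exact absurd h (mul_pos n1 n2).ne'
  refine ⟨key, ?_⟩
  rw [chordCot_quarter, div_eq_div_iff n1.ne' hpos.ne']
  linear_combination -key

/-- The invariant curve is the graph of `arcsin (h / R)`, and the orthoptic curve of the table is
the circle of radius `R`. -/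
theorem IsNormalParam.exists_radius (hγ : IsTable γ P) (hp : IsNormalParam γ P ψ σ)
    {α : Set (ℝ × ℝ)} (hα : IsRotationalCurve P α) (hper : ConsistsOfPeriodicOrbits γ P 4 α)
    (hrot : HasRotationNumber γ P α (1 / 4)) :
    ∃ R : ℝ, 0 < R ∧
      (∀ x, supportFunction γ x ^ 2 + supportFunction γ (x + Real.pi / 2) ^ 2 = R ^ 2) ∧
      α = {w | w.2 = Real.arcsin (supportFunction γ (ψ w.1) / R)} := by
  obtain ⟨c, hc, hcα, -, hcP, hinj⟩ := hα
  have hmem : ∀ t, c t ∈ α := fun t => hcα ▸ mem_range_self t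
  choose z hz hz0 hzα hzk using fun t => hper (c t) (hmem t)
  have hper' : ∀ t n, z t (n + 4) = z t n + (P, 0) := by
    intro t n
    obtain ⟨k, hk⟩ := hzk t
    have h1 := period_eq_one hγ hk (hrot (z t) (hz t) (hzα t 0))
    have := hk n
    rw [h1] at this
    simpa using this
  have hX := hp.isOrbitFamily hc hcP hinj hz hz0 (fun t n => hcα ▸ hzα t n) hper'
  have hq := hp.quarter hz hX
  have hall : ∀ x, chordCot (supportFunction γ) x (x + Real.pi / 2)
      + chordCot (supportFunction γ) x (x - Real.pi / 2) = 0 := by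
    intro x
    obtain ⟨t, ht⟩ := hX.surjective 1 x
    obtain ⟨t', ht'⟩ := hX.shift t
    have h1 := (hX.orbit t).reflect 0
    have h2 := hq t'
    simp only at ht ht' h1
    rw [ht', ht'] at h2
    norm_num at h1 h2
    rw [h2, ht] at h1
    have h3 : ψ (z t 0).1 = x - Real.pi / 2 := by linarith [hq t]
    rwa [h3] at h1
  have hsq : ∀ x, supportFunction γ x ^ 2 + supportFunction γ (x + Real.pi / 2) ^ 2 =
      supportFunction γ 0 ^ 2 + supportFunction γ (0 + Real.pi / 2) ^ 2 := by
    have hd : ∀ x, HasDerivAt (fun x => supportFunction γ x ^ 2 +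
        supportFunction γ (x + Real.pi / 2) ^ 2) 0 x := by
      intro x
      refine (((hp.hasDerivAt_support x).pow 2).add
        (((hp.hasDerivAt_support (x + Real.pi / 2)).comp_add_const x (Real.pi / 2)).pow
          2)).congr_deriv ?_
      simp
      linear_combination 2 * (hp.cross_eq_zero (hall x)).1
    intro x
    exact is_const_of_deriv_eq_zero (fun x => (hd x).differentiableAt)
      (fun x => (hd x).deriv) x 0
  set R := Real.sqrt (supportFunction γ 0 ^ 2 + supportFunction γ (0 + Real.pi / 2) ^ 2) with hR
  have hpos0 := hp.pos 0
  have hRpos : 0 < R := Real.sqrt_pos.2 (by positivity)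
  have hRsq : R ^ 2 = supportFunction γ 0 ^ 2 + supportFunction γ (0 + Real.pi / 2) ^ 2 :=
    Real.sq_sqrt (by positivity)
  have hsq' : ∀ x, supportFunction γ x ^ 2 + supportFunction γ (x + Real.pi / 2) ^ 2 = R ^ 2 :=
    fun x => by rw [hsq x, hRsq]
  refine ⟨R, hRpos, hsq', ?_⟩
  have hgraph : ∀ t, (c t).2 = Real.arcsin (supportFunction γ (ψ (c t).1) / R) := by
    intro t
    have s0 := hp.step (hz t 0)
    rw [zero_add, hq t] at s0
    have h1 := s0.2.2.1
    have hmem := (hz t 0).1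
    rw [hz0] at h1 hmem
    set x := ψ (c t).1 with hx
    rw [(hp.cross_eq_zero (hall x)).2] at h1
    have hs := Real.sin_pos_of_mem_Ioo hmem
    have p0 := hp.pos x
    have p1 := hp.pos (x + Real.pi / 2)
    rw [div_eq_div_iff p0.ne' hs.ne'] at h1
    have hcs := Real.sin_sq_add_cos_sq (c t).2
    -- Positivity of both support values makes `δ` acute, which selects the branch of `arcsin`.
    have hcos : 0 < Real.cos (c t).2 := by
      have : 0 < Real.cos (c t).2 * supportFunction γ x := by rw [← h1]; exact mul_pos p1 hs
      exact pos_of_mul_pos_left this p0.le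
    have h2 : (R * Real.sin (c t).2) ^ 2 = supportFunction γ x ^ 2 := by
      rw [mul_pow, ← hsq' x]
      linear_combination (supportFunction γ (x + Real.pi / 2) * Real.sin (c t).2
        + Real.cos (c t).2 * supportFunction γ x) * h1 + supportFunction γ x ^ 2 * hcs
    have h3 : R * Real.sin (c t).2 = supportFunction γ x :=
      (sq_eq_sq₀ (by positivity) p0.le).1 h2
    rw [← h3, mul_div_cancel_left₀ _ hRpos.ne', Real.arcsin_sin]
    · linarith [hmem.1, Real.pi_pos]
    · by_contra hcon
      push Not at hcon
      have := Real.cos_nonpos_of_pi_div_two_le_of_le hcon.le (by linarith [hmem.2, Real.pi_pos])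
      linarith
  ext w
  constructor
  · intro hw
    rw [← hcα] at hw
    obtain ⟨t, rfl⟩ := hw
    exact hgraph t
  · intro hw
    obtain ⟨t, ht⟩ := hX.surjective 0 (ψ w.1)
    simp only [hz0] at ht
    have h1 := hp.strictMono.injective ht
    have h2 : c t = w := by
      ext
      · exact h1
      · rw [hgraph, h1]; exact hw.symm
    exact h2 ▸ hmem t

end Curve

/-! ### The domain between an invariant graph and the reversed graph -/

/-- A path to the top avoiding the graph keeps `δ - d` nonzero, hence of constant sign; conversely
vertical segments join. -/
theorem upperSide_graph {d : ℝ → ℝ} (hd : Continuous d) (h0 : ∀ s, 0 < d s)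
    (hπ : ∀ s, d s < Real.pi) :
    upperSide {w : ℝ × ℝ | w.2 = d w.1} = {w | d w.1 < w.2 ∧ w.2 ≤ Real.pi} := by
  ext w
  constructor
  · rintro ⟨s, p, hp⟩
    have hw := hp 0
    rw [p.source] at hw
    refine ⟨?_, hw.1.2.2⟩
    by_contra hle
    push Not at hle
    have hg : Continuous fun t => (p t).2 - d (p t).1 := by fun_prop
    obtain ⟨t, ht⟩ := mem_range_of_exists_le_of_exists_ge hg
      (c := 0) ⟨0, by rw [p.source]; linarith⟩ ⟨1, by rw [p.target]; linarith [hπ s]⟩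
    exact (hp t).2 (sub_eq_zero.1 ht)
  · rintro ⟨h1, h2⟩
    refine ⟨w.1, JoinedIn.of_segment_subset ?_⟩
    rintro _ ⟨a, b, ha, hb, hab, rfl⟩
    have e1 : a * w.1 + b * w.1 = w.1 := by rw [← add_mul, hab, one_mul]
    have e2 : w.2 ≤ a * w.2 + b * Real.pi := by
      obtain rfl : a = 1 - b := by linarith
      nlinarith
    have e3 : a * w.2 + b * Real.pi ≤ Real.pi := by
      obtain rfl : b = 1 - a := by linarith
      nlinarith
    have := h0 w.1
    refine ⟨⟨mem_univ _, ?_, ?_⟩, fun h => ?_⟩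
    · simp; linarith
    · simpa using e3
    · simp [e1] at h
      linarith

theorem lowerSide_graph {d : ℝ → ℝ} (hd : Continuous d) (h0 : ∀ s, 0 < d s)
    (hπ : ∀ s, d s < Real.pi) :
    lowerSide {w : ℝ × ℝ | w.2 = d w.1} = {w | 0 ≤ w.2 ∧ w.2 < d w.1} := by
  ext w
  constructor
  · rintro ⟨s, p, hp⟩
    have hw := hp 0
    rw [p.source] at hw
    refine ⟨hw.1.2.1, ?_⟩
    by_contra hle
    push Not at hle
    have hg : Continuous fun t => (p t).2 - d (p t).1 := by fun_prop
    obtain ⟨t, ht⟩ := mem_range_of_exists_le_of_exists_ge hg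
      (c := 0) ⟨1, by rw [p.target]; linarith [h0 s]⟩ ⟨0, by rw [p.source]; linarith⟩
    exact (hp t).2 (sub_eq_zero.1 ht)
  · rintro ⟨h1, h2⟩
    refine ⟨w.1, JoinedIn.of_segment_subset ?_⟩
    rintro _ ⟨a, b, ha, hb, hab, rfl⟩
    have e1 : a * w.1 + b * w.1 = w.1 := by rw [← add_mul, hab, one_mul]
    have e2 : a * w.2 ≤ w.2 := by nlinarith
    have e3 : 0 ≤ a * w.2 := mul_nonneg ha h1
    have := hπ w.1
    refine ⟨⟨mem_univ _, ?_, ?_⟩, fun h => ?_⟩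
    · simpa using e3
    · simp; linarith
    · simp [e1] at h
      linarith

section Region

variable {γ : ℝ → ℂ} {P : ℝ} {α : Set (ℝ × ℝ)}

/-- Invariance puts the endpoint of a line of `α` back on `α`, and the preceding point of an orbit
shows that every line of `α` arises as such an image. Reversal thus becomes `δ ↦ π - δ`. -/
theorem reversed_eq (hinv : IsInvariant γ P α) (hper : ConsistsOfPeriodicOrbits γ P 4 α) :
    reversed γ P α = {w | (w.1, Real.pi - w.2) ∈ α} := by
  ext w
  constructor
  · rintro ⟨z, hz, z₁, hstep, rfl⟩
    have := (hinv z z₁ hstep).1 hz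
    simpa using this
  · intro hw
    obtain ⟨z, hz, hz0, hzα, -⟩ := hper _ hw
    have h := hz (-1)
    rw [neg_add_cancel, hz0] at h
    exact ⟨z (-1), hzα _, _, h, by ext <;> simp⟩

theorem regionBetween_eq {d : ℝ → ℝ} (hd : Continuous d) (h0 : ∀ s, 0 < d s)
    (hπ : ∀ s, d s < Real.pi / 2) (hinv : IsInvariant γ P α)
    (hper : ConsistsOfPeriodicOrbits γ P 4 α) (hα : α = {w | w.2 = d w.1}) :
    regionBetween γ P α = {w | w.2 ∈ Ioo (d w.1) (Real.pi - d w.1)} := by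
  have hrev : reversed γ P α = {w | w.2 = Real.pi - d w.1} := by
    rw [reversed_eq hinv hper, hα]
    ext w
    simp only [mem_ofPred_eq]
    constructor <;> intro h <;> linarith
  have hd' : Continuous fun s => Real.pi - d s := by fun_prop
  have hpi := Real.pi_pos
  rw [regionBetween, hrev, hα, upperSide_graph hd h0 (fun s => by linarith [hπ s]),
    lowerSide_graph hd' (fun s => by linarith [hπ s]) (fun s => by linarith [h0 s])]
  ext w
  constructor
  · rintro ⟨h1, h2⟩
    exact ⟨h1.1, h2.2⟩
  · rintro ⟨h1, h2⟩
    have := h0 w.1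
    exact ⟨⟨h1, by linarith⟩, by linarith, h2⟩

end Region

theorem integral_sin_sq_wedge {θ : ℝ} (h : θ ≤ Real.pi / 2) :
    ∫ δ in Ioo θ (Real.pi - θ), Real.sin δ ^ 2 = wedge θ := by
  rw [← integral_Ioc_eq_integral_Ioo, ← intervalIntegral.integral_of_le (by linarith),
    integral_sin_sq, Real.sin_pi_sub, Real.cos_pi_sub, wedge]
  ring

/-- Integration over the domain between a graph and its reversal. -/
theorem integral_invMeasure_graph {P : ℝ} (hP : 0 ≤ P) {g d : ℝ → ℝ} (hg : Continuous g)
    (hd : Continuous d) (h0 : ∀ s, 0 < d s) (hπ : ∀ s, d s < Real.pi / 2) :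
    IntegrableOn (fun z : ℝ × ℝ => g z.1 * Real.sin z.2)
      {w | w.2 ∈ Ioo (d w.1) (Real.pi - d w.1)} (invMeasure P) ∧
    ∫ z in {w : ℝ × ℝ | w.2 ∈ Ioo (d w.1) (Real.pi - d w.1)}, g z.1 * Real.sin z.2
      ∂(invMeasure P) = ∫ s in (0 : ℝ)..P, g s * wedge (d s) := by
  set B : Set (ℝ × ℝ) := {w | w.2 ∈ Ioo (d w.1) (Real.pi - d w.1)} with hB
  have hBm : MeasurableSet B := by
    apply IsOpen.measurableSet
    exact (isOpen_lt (hd.comp continuous_fst) continuous_snd).inter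
      (isOpen_lt continuous_snd (continuous_const.sub (hd.comp continuous_fst)))
  set S : Set (ℝ × ℝ) := Ico 0 P ×ˢ Ioo 0 Real.pi
  have hmeas : Measurable fun z : ℝ × ℝ => ENNReal.ofReal (Real.sin z.2) :=
    (Real.continuous_sin.comp continuous_snd).measurable.ennreal_ofReal
  have hcont : Continuous fun z : ℝ × ℝ =>
      (ENNReal.ofReal (Real.sin z.2)).toReal • (g z.1 * Real.sin z.2) := by
    simp only [ENNReal.toReal_ofReal']
    fun_prop
  have hint : IntegrableOn (fun z : ℝ × ℝ =>
      (ENNReal.ofReal (Real.sin z.2)).toReal • (g z.1 * Real.sin z.2)) S := by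
    apply (hcont.continuousOn.integrableOn_compact
      (isCompact_Icc.prod isCompact_Icc : IsCompact (Icc 0 P ×ˢ Icc 0 Real.pi))).mono_set
    exact prod_mono Ico_subset_Icc_self Ioo_subset_Icc_self
  refine ⟨?_, ?_⟩
  · apply Integrable.integrableOn
    rw [invMeasure, integrable_withDensity_iff_integrable_smul' hmeas
      (Eventually.of_forall fun _ => ENNReal.ofReal_lt_top)]
    exact hint
  -- The density contributes a second factor `sin δ`, so each fibre integral is `g s` times the
  -- integral of `sin² δ`, that is `wedge (d s)`.
  · rw [invMeasure, setIntegral_withDensity_eq_setIntegral_toReal_smul hmeas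
      (Eventually.of_forall fun _ => ENNReal.ofReal_lt_top) _ hBm,
      ← integral_indicator hBm, Measure.volume_eq_prod,
      setIntegral_prod _ (by
        rw [← Measure.volume_eq_prod]
        exact hint.indicator hBm),
      integral_Ico_eq_integral_Ioo, ← integral_Ioc_eq_integral_Ioo,
      ← intervalIntegral.integral_of_le hP]
    refine intervalIntegral.integral_congr fun s _ => ?_
    have hsub : Ioo 0 Real.pi ∩ Ioo (d s) (Real.pi - d s) = Ioo (d s) (Real.pi - d s) := by
      apply inter_eq_right.2
      have := h0 s
      exact Ioo_subset_Ioo this.le (by linarith)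
    have hind : (fun δ => B.indicator (fun z : ℝ × ℝ =>
        (ENNReal.ofReal (Real.sin z.2)).toReal • (g z.1 * Real.sin z.2)) (s, δ)) =
        (Ioo (d s) (Real.pi - d s)).indicator (fun δ =>
        (ENNReal.ofReal (Real.sin δ)).toReal • (g s * Real.sin δ)) := by
      ext δ
      by_cases h : δ ∈ Ioo (d s) (Real.pi - d s)
      · rw [indicator_of_mem h, indicator_of_mem (show (s, δ) ∈ B from h)]
      · rw [indicator_of_notMem h, indicator_of_notMem (show (s, δ) ∉ B from h)]
    rw [hind, setIntegral_indicator measurableSet_Ioo, hsub,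
      ← integral_sin_sq_wedge (hπ s).le, ← integral_const_mul]
    refine setIntegral_congr_fun measurableSet_Ioo fun δ hδ => ?_
    have := h0 s
    have hsin := Real.sin_pos_of_mem_Ioo (show δ ∈ Ioo 0 Real.pi from
      ⟨by linarith [hδ.1], by linarith [hδ.2]⟩)
    simp only [ENNReal.toReal_ofReal hsin.le, smul_eq_mul]
    ring

/-! ### Perimeter and the change of variable from arc length to normal angle -/

section Final

variable {γ : ℝ → ℂ} {P : ℝ} {ψ σ : ℝ → ℝ}

theorem IsNormalParam.deriv_deriv_periodic (hp : IsNormalParam γ P ψ σ) :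
    Function.Periodic (deriv (deriv (supportFunction γ))) (2 * Real.pi) := fun x => by
  rw [← deriv_comp_add_const]; congr 1; exact funext hp.deriv_periodic_two_pi

theorem IsNormalParam.integrand_eq (hp : IsNormalParam γ P ψ σ) :
    integrand γ = fun z => deriv (deriv (supportFunction γ)) (ψ z.1) * Real.sin z.2 := by
  ext z
  have h1 : normalAngle γ z.1 = toIocMod Real.two_pi_pos (-Real.pi) (ψ z.1) := by
    rw [normalAngle, hp.tangent, ← mul_assoc, ← Complex.arg_exp_mul_I]
    simp
  rw [integrand, h1, toIocMod, hp.deriv_deriv_periodic.sub_zsmul_eq]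

/-- Cauchy's formula: `σ' = h + h''` integrates to `P` over one turn, and `h''` integrates to zero.
-/
theorem IsNormalParam.perimeter_eq (hp : IsNormalParam γ P ψ σ) :
    ∫ x in (0 : ℝ)..2 * Real.pi, supportFunction γ x = P := by
  have c0 := hp.continuous_support
  have c2 := hp.continuous_deriv_deriv
  have h1 := intervalIntegral.integral_eq_sub_of_hasDerivAt (a := 0) (b := 2 * Real.pi)
    (fun x _ => hp.hasDerivAt x) ((c0.add c2).intervalIntegrable _ _)
  have h2 := intervalIntegral.integral_eq_sub_of_hasDerivAt (a := 0) (b := 2 * Real.pi)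
    (fun x _ => hp.hasDerivAt_deriv x) (c2.intervalIntegrable _ _)
  rw [intervalIntegral.integral_add (c0.intervalIntegrable _ _) (c2.intervalIntegrable _ _)] at h1
  have h3 := hp.param_add 0
  have h4 := hp.deriv_periodic_two_pi 0
  rw [zero_add] at h3 h4
  rw [h4, sub_self] at h2
  linarith

theorem IsNormalParam.integral_comp_angle (hp : IsNormalParam γ P ψ σ) {g : ℝ → ℝ}
    (hg : Continuous g) (hper : Function.Periodic g (2 * Real.pi)) :
    ∫ s in (0 : ℝ)..P, g (ψ s) = ∫ x in (0 : ℝ)..2 * Real.pi,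
      g x * (supportFunction γ x + deriv (deriv (supportFunction γ)) x) := by
  have h1 := intervalIntegral.integral_comp_mul_deriv (a := ψ 0) (b := ψ 0 + 2 * Real.pi)
    (f := σ) (g := fun s => g (ψ s)) (fun x _ => hp.hasDerivAt x)
    (hp.continuous_support.add hp.continuous_deriv_deriv).continuousOn
    (hg.comp hp.continuous_angle)
  rw [hp.param_add, hp.left_inv, zero_add] at h1
  rw [← h1]
  simp only [Function.comp, hp.right_inv]
  have hper' : Function.Periodic (fun x =>
      g x * (supportFunction γ x + deriv (deriv (supportFunction γ)) x)) (2 * Real.pi) :=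
    fun x => by simp only [hper _, hp.periodic_two_pi _, hp.deriv_deriv_periodic _]
  have := hper'.intervalIntegral_add_eq (ψ 0) 0
  rwa [zero_add] at this

end Final

end Billiard

end

theorem mainTheorem5 (γ : ℝ → ℂ) (P : ℝ) (hγ : Billiard.IsTable γ P)
    (α : Set (ℝ × ℝ)) (hα : Billiard.IsRotationalCurve P α)
    (hinv : Billiard.IsInvariant γ P α)
    (hper : Billiard.ConsistsOfPeriodicOrbits γ P 4 α)
    (hrot : Billiard.HasRotationNumber γ P α (1 / 4)) :
    ContDiff ℝ 2 (Billiard.supportFunction γ) ∧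
    IntegrableOn (Billiard.integrand γ) (Billiard.regionBetween γ P α) (Billiard.invMeasure P) ∧
    3 / 8 * (P ^ 2 - 4 * Real.pi * Billiard.area γ) ≤
      ∫ z in Billiard.regionBetween γ P α, Billiard.integrand γ z ∂(Billiard.invMeasure P) := by
  obtain ⟨ψ, σ, hp⟩ := hγ.exists_isNormalParam
  obtain ⟨R, hR, hsq, hgraph⟩ := hp.exists_radius hγ hα hper hrot
  have hpi := Real.pi_pos
  have c0 := hp.continuous_support
  have c2 := hp.continuous_deriv_deriv
  have cψ := hp.continuous_angle
  have hlt : ∀ x, Billiard.supportFunction γ x / R < 1 := fun x => by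
    rw [div_lt_one hR]
    have h1 := hsq x
    have h2 := pow_pos (hp.pos (x + Real.pi / 2)) 2
    exact lt_of_pow_lt_pow_left₀ 2 hR.le (by linarith)
  have ca : Continuous fun x => Real.arcsin (Billiard.supportFunction γ x / R) :=
    Real.continuous_arcsin.comp (c0.div_const R)
  have hd : Continuous fun s => Real.arcsin (Billiard.supportFunction γ (ψ s) / R) :=
    ca.comp cψ
  have h0 : ∀ s, 0 < Real.arcsin (Billiard.supportFunction γ (ψ s) / R) := fun s =>
    Real.arcsin_pos.2 (div_pos (hp.pos _) hR)
  have hπ : ∀ s, Real.arcsin (Billiard.supportFunction γ (ψ s) / R) < Real.pi / 2 := fun s =>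
    Real.arcsin_lt_pi_div_two.2 (hlt _)
  rw [Billiard.regionBetween_eq hd h0 hπ hinv hper hgraph, hp.integrand_eq]
  obtain ⟨hint, heq⟩ := Billiard.integral_invMeasure_graph hγ.pos.le (c2.comp cψ) hd h0 hπ
  refine ⟨hp.contDiff, hint, ?_⟩
  refine le_trans ?_ heq.ge
  have hchange := hp.integral_comp_angle
    (g := fun x => deriv (deriv (Billiard.supportFunction γ)) x
      * Billiard.wedge (Real.arcsin (Billiard.supportFunction γ x / R)))
    (c2.mul (Billiard.continuous_wedge.comp ca))
    (fun x => by simp only [hp.deriv_deriv_periodic _, hp.periodic_two_pi _])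
  have hmain := Billiard.orthoptic_inequality hp.contDiff hp.pos hp.periodic hR hsq
  have harea := Billiard.IsNormalParam.half_integral_le_area hγ hp
  rw [hp.perimeter_eq] at hmain
  simp only [Function.comp]
  rw [hchange]
  have e : ∀ x, deriv (deriv (Billiard.supportFunction γ)) x
      * Billiard.wedge (Real.arcsin (Billiard.supportFunction γ x / R))
      * (Billiard.supportFunction γ x + deriv (deriv (Billiard.supportFunction γ)) x) =
      deriv (deriv (Billiard.supportFunction γ)) x
      * (Billiard.supportFunction γ x + deriv (deriv (Billiard.supportFunction γ)) x)
      * Billiard.wedge (Real.arcsin (Billiard.supportFunction γ x / R)) := fun x => by ring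
  simp_rw [e]
  refine le_trans ?_ hmain
  -- The area bound, scaled by `4π`, replaces `2π ∫ h (h + h'')` by the larger `4πA`, which only
  -- lowers the left side.
  have := mul_le_mul_of_nonneg_left harea (show 0 ≤ 4 * Real.pi by positivity)
  linarith
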